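/- **Setting.** There are $K$ arms. Arm $i$ has an online reward law $P_i^{(\mathrm{on})}$ and an offline law $P_i^{(\mathrm{off})}$, both on $[0,1]$, with means $\mu_i^{(\mathrm{on})}$ and $\mu_i^{(\mathrm{off})}$; arm $1$ is the unique arm with the largest online mean, and $\Delta_i=\mu_1^{(\mathrm{on})}-\mu_i^{(\mathrm{on})}>0$ for $i\neq 1$. For every arm $i$ one is given $N_i\ge 0$ i.i.d. samples from $P_i^{(\mathrm{off})}$ with sample mean $\hat\mu_i^{(\mathrm{off})}$ (set to $0$ if $N_i=0$), and a number $V_i\ge 0$ with $|\mu_i^{(\mathrm{off})}-\mu_i^{(\mathrm{on})}|\le V_i$. Pulling arm $i$ yields an independent draw from $P_i^{(\mathrm{on})}$. **Anchor-TS.** At the beginning of round $t$ let $T_i$ be the number of earlier pulls of arm $i$ and $S_i$ the sum of the rewards they gave. Put $\hat\mu_i^{(\mathrm{on})}=\frac{S_i}{T_i+1}$. If $T_i\ge 1$ put $\hat\mu_i^{(\mathrm{hyb})}=\frac{S_i+N_i\hat\mu_i^{(\mathrm{off})}}{T_i+N_i+1}$ and $Z_i=\frac{N_iV_i}{T_i+N_i}$;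 if $T_i=0$ put $\hat\mu_i^{(\mathrm{hyb})}=\hat\mu_i^{(\mathrm{off})}$ and $Z_i=V_i$. For every arm draw, independently, $$\theta_i^{(\mathrm{on})}\sim\mathcal N\Big(\hat\mu_i^{(\mathrm{on})},\tfrac1{T_i+1}\Big),\qquad \theta_i^{(\mathrm{hyb})}\sim\mathcal N\Big(\hat\mu_i^{(\mathrm{hyb})}+Z_i,\tfrac1{T_i+N_i+1}\Big),$$ and pull an arm that maximizes $\mathrm{median}\{\hat\mu_i^{(\mathrm{on})},\theta_i^{(\mathrm{on})},\theta_i^{(\mathrm{hyb})}\}$, ties being broken by any fixed measurable rule, which may depend on the round. The regret is $\mathrm{Reg}(T)=T\mu_1^{(\mathrm{on})}-\mathbb E\big[\sum_{t=1}^T R_t\big]$, where $R_t$ is the reward observed in round $t$. **Theorem.** Let $\omega_i=V_i+\mu_i^{(\mathrm{off})}-\mu_i^{(\mathrm{on})}$ and $x_+=\max\{x,0\}$. There are absolute constants $C,C_1,C_2,C_3>0$ such that for every such instance and every horizon $T\ge 1$ $$\mathrm{Reg}(T)\le C\sum_{i\neq 1}\Delta_i\left(\left(\frac{C_1\log T}{\Delta_i^2}-N_i\Big(1-\frac{3\omega_i}{\Delta_i}\Big)_+\right)_+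 +\left(\frac{C_2\log T}{\Delta_i^2}-N_1\right)_+ +\frac{C_3}{\Delta_i^2}\right).$$ In particular, the regret never exceeds the order of the bound for purely online Thompson sampling: $$\mathrm{Reg}(T)\le C\sum_{i\neq 1}\frac{(C_1+C_2)\log T+C_3}{\Delta_i}.$$ -/

import Mathlib

open MeasureTheory ProbabilityTheory

/-- A `K`-armed offline-to-online bandit instance: online and offline reward laws on `[0, 1]`,
offline sample sizes `N i`, and known bounds `V i` on the shift of the means. -/
structure OfflineOnlineBandit (K : ℕ) where
  /-- online reward law of each arm -/
  onLaw : Fin K → Measure ℝ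
  /-- offline reward law of each arm -/
  offLaw : Fin K → Measure ℝ
  /-- offline sample size of each arm -/
  N : Fin K → ℕ
  /-- known bound on the distance between the offline and the online mean -/
  V : Fin K → ℝ
  onLaw_prob : ∀ i, IsProbabilityMeasure (onLaw i)
  offLaw_prob : ∀ i, IsProbabilityMeasure (offLaw i)
  onLaw_supp : ∀ i, ∀ᵐ x ∂(onLaw i), x ∈ Set.Icc (0 : ℝ) 1
  offLaw_supp : ∀ i, ∀ᵐ x ∂(offLaw i), x ∈ Set.Icc (0 : ℝ) 1
  V_nonneg : ∀ i, 0 ≤ V i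
  shift_le : ∀ i, |(∫ x, x ∂(offLaw i)) - ∫ x, x ∂(onLaw i)| ≤ V i

/-- The independent real random sources of the interaction. -/
inductive RandomSource (K : ℕ) (N : Fin K → ℕ) : Type
  /-- the `n`-th offline sample of arm `i` -/
  | offline (i : Fin K) (n : Fin (N i)) : RandomSource K N
  /-- the reward revealed by the online pull number `n` of arm `i`, counted from `0` -/
  | reward (i : Fin K) (n : ℕ) : RandomSource K N
  /-- the standard normal variable behind the online posterior sample of arm `i` in round `t` -/
  | onNoise (t : ℕ) (i : Fin K) : RandomSource K N
  /-- the standard normal variable behind the hybrid posterior sample of arm `i` in round `t` -/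
  | hybNoise (t : ℕ) (i : Fin K) : RandomSource K N

/-- What the algorithm has collected online: for each arm the number of pulls `T_i` and the sum of
the observed rewards. -/
structure PullState (K : ℕ) where
  pulls : Fin K → ℕ
  rewardSum : Fin K → ℝ

/-- The median of three real numbers. -/
def median3 (a b c : ℝ) : ℝ := max (min a b) (min (max a b) c)

namespace OfflineOnlineBandit

noncomputable section

variable {K : ℕ} (B : OfflineOnlineBandit K)

/-- Online mean of arm `i`. -/
def muOn (i : Fin K) : ℝ := ∫ x, x ∂(B.onLaw i)

/-- Offline mean of arm `i`. -/
def muOff (i : Fin K) : ℝ := ∫ x, x ∂(B.offLaw i)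

/-- Gap of arm `i` to the arm `best`. -/
def gap (best i : Fin K) : ℝ := B.muOn best - B.muOn i

/-- Effective discrepancy of arm `i`. -/
def discrepancy (i : Fin K) : ℝ := B.V i + B.muOff i - B.muOn i

/-- Law of each random source. -/
def sourceLaw : RandomSource K B.N → Measure ℝ
  | .offline i _ => B.offLaw i
  | .reward i _ => B.onLaw i
  | .onNoise _ _ => gaussianReal 0 1
  | .hybNoise _ _ => gaussianReal 0 1

instance sourceLaw_prob (s : RandomSource K B.N) : IsProbabilityMeasure (B.sourceLaw s) := by
  cases s with
  | offline i n => exact B.offLaw_prob i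
  | reward i n => exact B.onLaw_prob i
  | onNoise t i => exact inferInstanceAs (IsProbabilityMeasure (gaussianReal 0 1))
  | hybNoise t i => exact inferInstanceAs (IsProbabilityMeasure (gaussianReal 0 1))

/-- The joint law of all random sources: they are mutually independent. -/
def prob : Measure (RandomSource K B.N → ℝ) := Measure.infinitePi B.sourceLaw

/-- Offline sample mean of arm `i`; it is `0` if the arm has no offline data. -/
def offMean (w : RandomSource K B.N → ℝ) (i : Fin K) : ℝ :=
  (∑ n : Fin (B.N i), w (.offline i n)) / (B.N i : ℝ)

/-- Mean of the online posterior of arm `i` (the online sample mean, regularized by the `+ 1`). -/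
def onPostMean (s : PullState K) (i : Fin K) : ℝ :=
  s.rewardSum i / ((s.pulls i : ℝ) + 1)

/-- Variance of the online posterior of arm `i`. -/
def onPostVar (s : PullState K) (i : Fin K) : ℝ :=
  1 / ((s.pulls i : ℝ) + 1)

/-- Mean of the hybrid posterior of arm `i` before the shift: the offline sample mean until the
first online pull, then the sum of all offline and online samples over their number plus one. -/
def hybPostMean (w : RandomSource K B.N → ℝ) (s : PullState K) (i : Fin K) : ℝ :=
  if s.pulls i = 0 then B.offMean w i
  else (s.rewardSum i + (B.N i : ℝ) * B.offMean w i) / ((s.pulls i : ℝ) + (B.N i : ℝ) + 1)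

/-- Variance of the hybrid posterior of arm `i`. -/
def hybPostVar (s : PullState K) (i : Fin K) : ℝ :=
  1 / ((s.pulls i : ℝ) + (B.N i : ℝ) + 1)

/-- The right shift `Z` of the hybrid posterior of arm `i`. -/
def shift (s : PullState K) (i : Fin K) : ℝ :=
  if s.pulls i = 0 then B.V i
  else (B.N i : ℝ) * B.V i / ((s.pulls i : ℝ) + (B.N i : ℝ))

/-- Online posterior sample of arm `i` in round `t`. -/
def onSample (w : RandomSource K B.N → ℝ) (s : PullState K) (t : ℕ) (i : Fin K) : ℝ :=
  onPostMean s i + Real.sqrt (onPostVar s i) * w (.onNoise t i)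

/-- Right-shifted hybrid posterior sample of arm `i` in round `t`. -/
def hybSample (w : RandomSource K B.N → ℝ) (s : PullState K) (t : ℕ) (i : Fin K) : ℝ :=
  B.hybPostMean w s i + B.shift s i + Real.sqrt (B.hybPostVar s i) * w (.hybNoise t i)

/-- Anchor-TS index of arm `i` in round `t`. -/
def armIndex (w : RandomSource K B.N → ℝ) (s : PullState K) (t : ℕ) (i : Fin K) : ℝ :=
  median3 (onPostMean s i) (B.onSample w s t i) (B.hybSample w s t i)

/-- State of Anchor-TS at the beginning of round `t` (rounds are counted from `0`); `sel t` picks a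
maximizer of the index vector of round `t`. -/
def state (sel : ℕ → (Fin K → ℝ) → Fin K) (w : RandomSource K B.N → ℝ) : ℕ → PullState K
  | 0 => ⟨fun _ => 0, fun _ => 0⟩
  | t + 1 =>
    let s := state sel w t
    let a := sel t (B.armIndex w s t)
    ⟨Function.update s.pulls a (s.pulls a + 1),
      Function.update s.rewardSum a (s.rewardSum a + w (.reward a (s.pulls a)))⟩

/-- The arm pulled by Anchor-TS in round `t`. -/
def action (sel : ℕ → (Fin K → ℝ) → Fin K) (w : RandomSource K B.N → ℝ) (t : ℕ) : Fin K :=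
  sel t (B.armIndex w (B.state sel w t) t)

/-- The reward observed by Anchor-TS in round `t`: a fresh draw from the online law of the pulled
arm. -/
def obsReward (sel : ℕ → (Fin K → ℝ) → Fin K) (w : RandomSource K B.N → ℝ) (t : ℕ) : ℝ :=
  w (.reward (B.action sel w t) ((B.state sel w t).pulls (B.action sel w t)))

/-- Cumulative regret of Anchor-TS over `T` rounds against always pulling `best`. -/
def regret (best : Fin K) (sel : ℕ → (Fin K → ℝ) → Fin K) (T : ℕ) : ℝ :=
  (T : ℝ) * B.muOn best - ∫ w, ∑ t ∈ Finset.range T, B.obsReward sel w t ∂B.prob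

end

end OfflineOnlineBandit

/-! The regret is the sum over suboptimal arms of the gap times the expected number of pulls
(`regret_eq_sum_gap_mul`), so one arm `i` of gap `Δ` can be treated at a time. Its pulls are split
by whether its index exceeds the level `y = μ_i + 2Δ/3 = μ_best - 2δ`, where `δ = Δ/6`.

Index at most `y`: then every index is at most `y`, including that of the best arm. With everything
but the best arm's noise of this round frozen, the probability of this is at most the odds of the
best index falling below `y` times the probability that it exceeds `y` while all others stay below,
and in the latter case the best arm is pulled (`measure_action_index_le`). Summed over rounds, the
odds are paid at most once per pull count `k` of the best arm. Their expectation decays like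
`exp(-δ²k/20)` (`lintegral_oddsAt_le`), so the total is `O(1/Δ²)` without a logarithm. The decay
comes from the anchor: once the online mean clears `y` by `δ`, the index drops below `y` only if the
online noise is very negative, whatever the hybrid sample does. If the mean does not clear `y`, the
inverse Gaussian tails are large, but they stay integrable because rewards in `[0, 1]` have variance
proxy `1/4`, while the posterior noise has variance proxy `1`.

Index above `y`: unless the centered sums are large, which costs `O(1/Δ²)` pulls, the anchor lies
below `y`, so both samples must exceed `y`. Either one may then be used to bound the pull count: the
hybrid sample, resting on `k + N_i` observations, if the discrepancy is at most `Δ/3`, and the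
online sample otherwise (`index_large_cases`). This yields the logarithmic term with the offline
saving. -/

/-! ### Independence of disjoint blocks of coordinates. -/

section Independence

variable {ι : Type*} {ν : ι → Measure ℝ} [∀ i, IsProbabilityMeasure (ν i)]

/-- Overwriting the coordinates outside `s` by `0` does not change `f`, and this overwriting map is
measurable for the σ-algebra generated by the coordinates in `s`. -/
theorem DependsOn.comap_le_iSup {β : Type*} [mβ : MeasurableSpace β] {f : (ι → ℝ) → β} {s : Set ι}
    (hf : Measurable f) (hs : DependsOn f s) :
    mβ.comap f ≤ ⨆ i ∈ s, (inferInstance : MeasurableSpace ℝ).comap fun w : ι → ℝ ↦ w i := by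
  classical
  set m := ⨆ i ∈ s, (inferInstance : MeasurableSpace ℝ).comap fun w : ι → ℝ ↦ w i with hm
  let g : (ι → ℝ) → ι → ℝ := fun w i ↦ if i ∈ s then w i else 0
  have hg : @Measurable _ _ m MeasurableSpace.pi g := by
    refine @measurable_pi_lambda _ _ _ m _ g fun i ↦ ?_
    by_cases hi : i ∈ s
    · simp only [g, hi, if_true]
      exact Measurable.mono (comap_measurable _) (le_iSup₂_of_le i hi le_rfl) le_rfl
    · simp only [g, hi, if_false]
      exact @measurable_const _ _ _ m _
  have hfg : f = f ∘ g := by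
    funext w
    exact hs fun i hi ↦ by simp [g, hi]
  rw [hfg]
  exact (hf.comp hg).comap_le

/-- Functions of disjoint blocks of coordinates of a product measure are independent. -/
theorem indepFun_infinitePi_of_dependsOn {β γ : Type*} [MeasurableSpace β] [MeasurableSpace γ]
    {f : (ι → ℝ) → β} {g : (ι → ℝ) → γ} {s t : Set ι} (hf : Measurable f) (hg : Measurable g)
    (hfs : DependsOn f s) (hgt : DependsOn g t) (hst : Disjoint s t) :
    IndepFun f g (Measure.infinitePi ν) := by
  have h : iIndepFun (fun (i : ι) (w : ι → ℝ) ↦ w i) (Measure.infinitePi ν) :=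
    iIndepFun_infinitePi (X := fun _ x ↦ x) fun _ ↦ measurable_id
  have h' := indep_iSup_of_disjoint (fun i ↦ (measurable_pi_apply i).comap_le) h hst
  exact indep_of_indep_of_le_left (indep_of_indep_of_le_right h' (hgt.comap_le_iSup hg))
    (hfs.comap_le_iSup hf)

end Independence

/-! ### Gaussian tails and exponential moments of squares. -/

section Gaussian

theorem hasSubgaussianMGF_id_gaussianReal :
    HasSubgaussianMGF (fun z : ℝ ↦ z) 1 (gaussianReal 0 1) where
  integrable_exp_mul t := by
    simpa using integrable_exp_mul_gaussianReal (μ := 0) (v := 1) t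
  mgf_le t := by
    rw [mgf_fun_id_gaussianReal]
    simp

theorem gaussianReal_Ici_le {a : ℝ} (ha : 0 ≤ a) :
    gaussianReal 0 1 (Set.Ici a) ≤ ENNReal.ofReal (Real.exp (-a ^ 2 / 2)) := by
  have h := hasSubgaussianMGF_id_gaussianReal.measure_ge_le ha
  rw [← ofReal_measureReal]
  refine ENNReal.ofReal_le_ofReal ?_
  have : Set.Ici a = {z : ℝ | a ≤ z} := rfl
  rw [this]
  simpa using h

theorem gaussianReal_Iic_neg_le {a : ℝ} (ha : 0 ≤ a) :
    gaussianReal 0 1 (Set.Iic (-a)) ≤ ENNReal.ofReal (Real.exp (-a ^ 2 / 2)) := by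
  have h := hasSubgaussianMGF_id_gaussianReal.neg.measure_ge_le ha
  rw [← ofReal_measureReal]
  refine ENNReal.ofReal_le_ofReal ?_
  have : Set.Iic (-a) = {z : ℝ | a ≤ (-fun z : ℝ ↦ z) z} := by
    ext z; simp [le_neg]
  rw [this]
  simpa using h

/-- An upper bound for the inverse of the standard normal tail at `a`. -/
noncomputable def invTailBound (a : ℝ) : ℝ := 3 * Real.exp ((max a 0 + 1) ^ 2 / 2)

theorem invTailBound_pos (a : ℝ) : 0 < invTailBound a := by
  unfold invTailBound; positivity

theorem measurable_invTailBound : Measurable invTailBound := by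
  unfold invTailBound; fun_prop

/-- With `b = max a 0`, the interval `(b, b + 1)` lies in the tail, has length `1`, and carries
density at least `exp(-(b + 1)² / 2) / 3`, because `√(2π) ≤ 3`. -/
theorem one_le_invTailBound_mul (a : ℝ) :
    1 ≤ ENNReal.ofReal (invTailBound a) * gaussianReal 0 1 (Set.Ioi a) := by
  set b := max a 0 with hb
  have hb0 : 0 ≤ b := le_max_right _ _
  have h1 : ENNReal.ofReal (invTailBound a)⁻¹ ≤ gaussianReal 0 1 (Set.Ioi a) := by
    calc ENNReal.ofReal (invTailBound a)⁻¹
        = ∫⁻ _ in Set.Ioo b (b + 1), ENNReal.ofReal (invTailBound a)⁻¹ := by simp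
      _ ≤ ∫⁻ x in Set.Ioo b (b + 1), gaussianPDF 0 1 x := by
          refine setLIntegral_mono (measurable_gaussianPDF _ _) fun x hx ↦ ?_
          rw [gaussianPDF]
          refine ENNReal.ofReal_le_ofReal ?_
          rw [gaussianPDFReal, invTailBound, mul_inv, ← Real.exp_neg, ← hb]
          simp only [NNReal.coe_one, mul_one, sub_zero]
          have hs : √(2 * Real.pi) ≤ 3 := by
            rw [Real.sqrt_le_left (by norm_num)]
            nlinarith [Real.pi_lt_d2]
          have hx2 : x ^ 2 ≤ (b + 1) ^ 2 := by
            have := hx.1; have := hx.2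
            gcongr
            linarith
          gcongr
          linarith
      _ = gaussianReal 0 1 (Set.Ioo b (b + 1)) := by
          rw [gaussianReal_apply _ one_ne_zero]
      _ ≤ gaussianReal 0 1 (Set.Ioi a) := measure_mono fun x hx ↦
          lt_of_le_of_lt (le_max_left a 0) hx.1
  calc (1 : ENNReal) = ENNReal.ofReal (invTailBound a) * ENNReal.ofReal (invTailBound a)⁻¹ := by
        rw [← ENNReal.ofReal_mul (invTailBound_pos a).le, mul_inv_cancel₀ (invTailBound_pos a).ne',
          ENNReal.ofReal_one]
    _ ≤ _ := by gcongr

/-- The Gaussian moment `E exp(9 g² / 20)`. -/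
noncomputable def gaussianSqExpMoment : ENNReal :=
  ∫⁻ g, ENNReal.ofReal (Real.exp (9 / 20 * g ^ 2)) ∂(gaussianReal 0 1)

theorem gaussianSqExpMoment_ne_top : gaussianSqExpMoment ≠ ⊤ := by
  have h : Integrable (fun g : ℝ ↦ Real.exp (9 / 20 * g ^ 2)) (gaussianReal 0 1) := by
    rw [gaussianReal_of_var_ne_zero _ one_ne_zero, gaussianPDF_def,
      integrable_withDensity_iff_integrable_smul' (by fun_prop) (by simp)]
    -- Against the Gaussian density the exponent becomes `9/20 - 1/2 = -1/20`.
    refine ((integrable_exp_neg_mul_sq (b := 1 / 20) (by norm_num)).const_mul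
      (√(2 * Real.pi))⁻¹).congr (ae_of_all _ fun x ↦ ?_)
    simp only [ENNReal.toReal_ofReal (gaussianPDFReal_nonneg _ _ _)]
    simp only [gaussianPDFReal, NNReal.coe_one, mul_one, sub_zero, smul_eq_mul]
    rw [mul_assoc, ← Real.exp_add]
    ring_nf
  rw [gaussianSqExpMoment, ← ofReal_integral_eq_lintegral_ofReal h (ae_of_all _ fun x ↦ by positivity)]
  exact ENNReal.ofReal_ne_top

/-- The exponential of the square of a sub-Gaussian variable is integrable up to its natural
threshold. -/
theorem ProbabilityTheory.HasSubgaussianMGF.lintegral_exp_sq_le {Ω : Type*} [MeasurableSpace Ω]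
    {P : Measure Ω} [IsProbabilityMeasure P] {D : Ω → ℝ} {c : NNReal} (h : HasSubgaussianMGF D c P)
    (hD : Measurable D) {a : ℝ} (ha : 0 ≤ a) (hac : a * c ≤ 9 / 20) :
    ∫⁻ w, ENNReal.ofReal (Real.exp (a * D w ^ 2)) ∂P ≤ gaussianSqExpMoment := by
  -- The square is linearized by an auxiliary Gaussian: `exp(a D²) = E_g exp(√(2a) D g)`. After
  -- exchanging the integrals, the sub-Gaussian bound on the moment generating function of `D`
  -- leaves `exp(a c g²)`.
  calc ∫⁻ w, ENNReal.ofReal (Real.exp (a * D w ^ 2)) ∂P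
      = ∫⁻ w, ∫⁻ g, ENNReal.ofReal (Real.exp (√(2 * a) * D w * g)) ∂(gaussianReal 0 1) ∂P := by
        refine lintegral_congr fun w ↦ ?_
        rw [← ofReal_integral_eq_lintegral_ofReal (integrable_exp_mul_gaussianReal _)
          (ae_of_all _ fun x ↦ by positivity)]
        have := congrFun (mgf_fun_id_gaussianReal (μ := 0) (v := 1)) (√(2 * a) * D w)
        rw [mgf] at this
        rw [this, mul_pow, Real.sq_sqrt (by positivity)]
        congr 2
        simp
        ring
    _ = ∫⁻ g, ∫⁻ w, ENNReal.ofReal (Real.exp (√(2 * a) * D w * g)) ∂P ∂(gaussianReal 0 1) := by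
        rw [lintegral_lintegral_swap]
        refine Measurable.aemeasurable ?_
        simp only [Function.uncurry_def]
        fun_prop
    _ ≤ ∫⁻ g, ENNReal.ofReal (Real.exp (9 / 20 * g ^ 2)) ∂(gaussianReal 0 1) := by
        refine lintegral_mono fun g ↦ ?_
        have h1 := h.mgf_le (√(2 * a) * g)
        have h2 : ∀ w, √(2 * a) * D w * g = √(2 * a) * g * D w := fun w ↦ by ring
        simp only [h2]
        rw [← ofReal_integral_eq_lintegral_ofReal (h.integrable_exp_mul _)
          (ae_of_all _ fun x ↦ by positivity)]
        refine ENNReal.ofReal_le_ofReal (h1.trans (Real.exp_le_exp.2 ?_))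
        rw [mul_pow, Real.sq_sqrt (by positivity)]
        nlinarith [sq_nonneg g]

end Gaussian

/-! ### Odds of the median index. -/

section Median

theorem lt_median3_iff {a b c y : ℝ} :
    y < median3 a b c ↔ (y < a ∧ y < b) ∨ ((y < a ∨ y < b) ∧ y < c) := by
  simp [median3]

theorem measurable_median3 : Measurable fun p : ℝ × ℝ × ℝ ↦ median3 p.1 p.2.1 p.2.2 := by
  unfold median3; fun_prop

/-- A bound for the odds of an anchored index to fall below a level, where `a` and `b` are the
standardized distances of the two posterior means to the level. -/
noncomputable def oddsBound (c a b : ℝ) : ℝ :=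
  if a ≤ -c then Real.exp (-c ^ 2 / 2) * invTailBound a else invTailBound a * invTailBound b

theorem measurable_oddsBound (c : ℝ) : Measurable fun p : ℝ × ℝ ↦ oddsBound c p.1 p.2 := by
  unfold oddsBound
  refine Measurable.ite (measurableSet_le measurable_fst measurable_const) ?_ ?_
  · exact (measurable_invTailBound.comp measurable_fst).const_mul _
  · exact (measurable_invTailBound.comp measurable_fst).mul
      (measurable_invTailBound.comp measurable_snd)

/-- The median exceeds `y` as soon as two of its arguments do. If the anchor `m` clears `y` by `c`
standard deviations, the online sample alone decides: failure forces its noise below `-c`, and noise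
above `a` gives success. Otherwise failure is bounded by `1`, and success by both samples exceeding
`y`, which has a product probability. -/
theorem measure_median3_le_le_oddsBound_mul {c y m h σ τ : ℝ} (hc : 0 < c) (hσ : 0 < σ)
    (hτ : 0 < τ) :
    ((gaussianReal 0 1).prod (gaussianReal 0 1))
        {z | median3 m (m + σ * z.1) (h + τ * z.2) ≤ y} ≤
      ENNReal.ofReal (oddsBound c ((y - m) / σ) ((y - h) / τ)) *
        ((gaussianReal 0 1).prod (gaussianReal 0 1))
          {z | y < median3 m (m + σ * z.1) (h + τ * z.2)} := by
  set a := (y - m) / σ with ha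
  set b := (y - h) / τ with hb
  have hlt1 : ∀ z : ℝ, a < z ↔ y < m + σ * z := fun z ↦ by
    rw [ha, div_lt_iff₀ hσ]; constructor <;> intro _ <;> linarith
  have hlt2 : ∀ z : ℝ, b < z ↔ y < h + τ * z := fun z ↦ by
    rw [hb, div_lt_iff₀ hτ]; constructor <;> intro _ <;> linarith
  unfold oddsBound
  split_ifs with hac
  · have hym : y < m := by
      have ha0 : a < 0 := by linarith
      rw [ha, div_lt_iff₀ hσ] at ha0
      linarith
    calc ((gaussianReal 0 1).prod (gaussianReal 0 1))
          {z | median3 m (m + σ * z.1) (h + τ * z.2) ≤ y}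
        ≤ ((gaussianReal 0 1).prod (gaussianReal 0 1)) (Set.Iic (-c) ×ˢ Set.univ) := by
          refine measure_mono fun z hz ↦ ⟨?_, Set.mem_univ _⟩
          by_contra hzc
          exact absurd hz (not_le.2 (lt_median3_iff.2
            (.inl ⟨hym, (hlt1 _).1 (hac.trans_lt (not_le.1 hzc))⟩)))
      _ ≤ ENNReal.ofReal (Real.exp (-c ^ 2 / 2)) := by simpa using gaussianReal_Iic_neg_le hc.le
      _ ≤ ENNReal.ofReal (Real.exp (-c ^ 2 / 2)) *
          (ENNReal.ofReal (invTailBound a) * gaussianReal 0 1 (Set.Ioi a)) :=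
          le_mul_of_one_le_right' (one_le_invTailBound_mul a)
      _ = ENNReal.ofReal (Real.exp (-c ^ 2 / 2) * invTailBound a) *
          ((gaussianReal 0 1).prod (gaussianReal 0 1)) (Set.Ioi a ×ˢ Set.univ) := by
          rw [ENNReal.ofReal_mul (by positivity), mul_assoc]
          simp
      _ ≤ _ := by
          gcongr
          rintro z ⟨hz, -⟩
          exact lt_median3_iff.2 (.inl ⟨hym, (hlt1 _).1 hz⟩)
  · calc ((gaussianReal 0 1).prod (gaussianReal 0 1))
          {z | median3 m (m + σ * z.1) (h + τ * z.2) ≤ y}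
        ≤ 1 := prob_le_one
      _ ≤ (ENNReal.ofReal (invTailBound a) * gaussianReal 0 1 (Set.Ioi a)) *
          (ENNReal.ofReal (invTailBound b) * gaussianReal 0 1 (Set.Ioi b)) :=
          one_le_mul (one_le_invTailBound_mul a) (one_le_invTailBound_mul b)
      _ = ENNReal.ofReal (invTailBound a * invTailBound b) *
          ((gaussianReal 0 1).prod (gaussianReal 0 1)) (Set.Ioi a ×ˢ Set.Ioi b) := by
          rw [ENNReal.ofReal_mul (invTailBound_pos a).le, Measure.prod_prod]
          ring
      _ ≤ _ := by
          gcongr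
          rintro z ⟨hz, hz'⟩
          exact lt_median3_iff.2 (.inr ⟨.inr ((hlt1 _).1 hz), (hlt2 _).1 hz'⟩)

end Median

/-- If the odds of an event given `u` are at most `r u`, its probability is at most the integral of
`r` over the complementary event, also after restricting to an event that depends on `u` only. -/
theorem ProbabilityTheory.IndepFun.measure_inter_le_lintegral {Ω α β : Type*} [MeasurableSpace Ω]
    [MeasurableSpace α] [MeasurableSpace β] {P : Measure Ω} [IsProbabilityMeasure P] {U : Ω → α}
    {Z : Ω → β} (hUZ : IndepFun U Z P) (hU : Measurable U) (hZ : Measurable Z) {A : Set (α × β)}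
    (hA : MeasurableSet A) {G : Set α} (hG : MeasurableSet G) {r : α → ENNReal} (hr : Measurable r)
    (h : ∀ u, P.map Z {z | (u, z) ∈ A} ≤ r u * P.map Z {z | (u, z) ∉ A}) :
    P {w | U w ∈ G ∧ (U w, Z w) ∈ A} ≤
      ∫⁻ w, {w | U w ∈ G ∧ (U w, Z w) ∉ A}.indicator (fun w ↦ r (U w)) w ∂P := by
  have hlaw := hUZ.map_prod_eq_prod_map_map hU.aemeasurable hZ.aemeasurable
  have := Measure.isProbabilityMeasure_map (μ := P) hZ.aemeasurable
  have hGA : MeasurableSet {p : α × β | p.1 ∈ G ∧ p ∈ A} := (measurable_fst hG).inter hA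
  have hGA' : MeasurableSet {p : α × β | p.1 ∈ G ∧ p ∉ A} := (measurable_fst hG).inter hA.compl
  have h1 : P {w | U w ∈ G ∧ (U w, Z w) ∈ A} =
      ∫⁻ u, P.map Z {z | u ∈ G ∧ (u, z) ∈ A} ∂(P.map U) := by
    have := Measure.map_apply (μ := P) (hU.prodMk hZ) hGA
    rw [hlaw, Measure.prod_apply hGA] at this
    exact this.symm
  have h2 : ∫⁻ w, {w | U w ∈ G ∧ (U w, Z w) ∉ A}.indicator (fun w ↦ r (U w)) w ∂P =
      ∫⁻ u, r u * P.map Z {z | u ∈ G ∧ (u, z) ∉ A} ∂(P.map U) := by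
    have hm : Measurable ({p : α × β | p.1 ∈ G ∧ p ∉ A}.indicator fun p ↦ r p.1) :=
      (hr.comp measurable_fst).indicator hGA'
    have h3 := lintegral_map (μ := P) hm (hU.prodMk hZ)
    rw [hlaw, lintegral_prod _ hm.aemeasurable] at h3
    refine h3.symm.trans (lintegral_congr fun u ↦ ?_)
    have hs : MeasurableSet {z | u ∈ G ∧ (u, z) ∉ A} := measurable_prodMk_left hGA'
    rw [← lintegral_indicator_const hs]
    rfl
  rw [h1, h2]
  refine lintegral_mono fun u ↦ ?_
  by_cases hu : u ∈ G
  · simpa [hu] using h u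
  · simp [hu]

/-! ### Dependence of the history on the random sources. -/

namespace RandomSource

/-- The posterior noise of the rounds before `t`, together with all offline data and rewards. -/
def before {K : ℕ} {N : Fin K → ℕ} (t : ℕ) : Set (RandomSource K N)
  | .offline _ _ => True
  | .reward _ _ => True
  | .onNoise t' _ => t' < t
  | .hybNoise t' _ => t' < t

end RandomSource

namespace OfflineOnlineBandit

noncomputable section

variable {K : ℕ} (B : OfflineOnlineBandit K) (sel : ℕ → (Fin K → ℝ) → Fin K)
  (w : RandomSource K B.N → ℝ)

/-- Online posterior mean of arm `i` after `k` pulls. -/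
def onMeanAt (i : Fin K) (k : ℕ) : ℝ :=
  (∑ n ∈ Finset.range k, w (.reward i n)) / ((k : ℝ) + 1)

/-- Shifted mean of the hybrid posterior of arm `i` after `k` pulls. -/
def hybMeanAt (i : Fin K) (k : ℕ) : ℝ :=
  if k = 0 then B.offMean w i + B.V i
  else (∑ n ∈ Finset.range k, w (.reward i n) + (B.N i : ℝ) * B.offMean w i) /
    ((k : ℝ) + (B.N i : ℝ) + 1) + (B.N i : ℝ) * B.V i / ((k : ℝ) + (B.N i : ℝ))

theorem pulls_succ (t : ℕ) (i : Fin K) :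
    (B.state sel w (t + 1)).pulls i =
      (B.state sel w t).pulls i + if B.action sel w t = i then 1 else 0 := by
  change Function.update (B.state sel w t).pulls (B.action sel w t) _ i = _
  by_cases h : B.action sel w t = i
  · subst h; simp [action]
  · rw [Function.update_of_ne (Ne.symm h)]; simp [h]

theorem rewardSum_succ (t : ℕ) (i : Fin K) :
    (B.state sel w (t + 1)).rewardSum i = (B.state sel w t).rewardSum i +
      if B.action sel w t = i then w (.reward i ((B.state sel w t).pulls i)) else 0 := by
  change Function.update (B.state sel w t).rewardSum (B.action sel w t) _ i = _
  by_cases h : B.action sel w t = i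
  · subst h; simp [action]
  · rw [Function.update_of_ne (Ne.symm h)]; simp [h]

/-- The pull count of `i` takes each value below its final one in exactly one round that pulls `i`.
This turns sums over random rounds into sums over pull counts. -/
theorem sum_range_action_eq {M : Type*} [AddCommMonoid M] (f : ℕ → M) (i : Fin K) (T : ℕ) :
    ∑ t ∈ Finset.range T, (if B.action sel w t = i then f ((B.state sel w t).pulls i) else 0) =
      ∑ k ∈ Finset.range ((B.state sel w T).pulls i), f k := by
  induction T with
  | zero => simp [state]
  | succ t ih =>
    rw [Finset.sum_range_succ, ih, pulls_succ]
    split_ifs with h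
    · rw [Finset.sum_range_succ]
    · simp

theorem pulls_le (t : ℕ) (i : Fin K) : (B.state sel w t).pulls i ≤ t := by
  induction t with
  | zero => simp [state]
  | succ t ih => rw [pulls_succ]; split_ifs <;> omega

theorem pulls_mono (i : Fin K) : Monotone fun t ↦ (B.state sel w t).pulls i :=
  monotone_nat_of_le_succ fun t ↦ by rw [pulls_succ]; omega

theorem rewardSum_eq_sum (t : ℕ) (i : Fin K) :
    (B.state sel w t).rewardSum i =
      ∑ n ∈ Finset.range ((B.state sel w t).pulls i), w (.reward i n) := by
  induction t with
  | zero => simp [state]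
  | succ t ih =>
    rw [rewardSum_succ, pulls_succ, ih]
    split_ifs with h
    · rw [Finset.sum_range_succ]
    · simp

theorem onPostMean_state (t : ℕ) (i : Fin K) :
    onPostMean (B.state sel w t) i = B.onMeanAt w i ((B.state sel w t).pulls i) := by
  rw [onPostMean, rewardSum_eq_sum, onMeanAt]

theorem hybPostMean_add_shift_state (t : ℕ) (i : Fin K) :
    B.hybPostMean w (B.state sel w t) i + B.shift (B.state sel w t) i =
      B.hybMeanAt w i ((B.state sel w t).pulls i) := by
  rw [hybPostMean, shift, hybMeanAt, rewardSum_eq_sum]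
  split_ifs <;> rfl

/-- Given the sources, the history enters an index only through the pull count, so statistics can be
studied at a deterministic count `k`. -/
theorem armIndex_state (t : ℕ) (i : Fin K) :
    B.armIndex w (B.state sel w t) t i =
      median3 (B.onMeanAt w i ((B.state sel w t).pulls i))
        (B.onMeanAt w i ((B.state sel w t).pulls i) +
          √(1 / (((B.state sel w t).pulls i : ℝ) + 1)) * w (.onNoise t i))
        (B.hybMeanAt w i ((B.state sel w t).pulls i) +
          √(1 / (((B.state sel w t).pulls i : ℝ) + (B.N i : ℝ) + 1)) * w (.hybNoise t i)) := by
  rw [armIndex, onSample, hybSample, hybPostMean_add_shift_state, onPostMean_state, onPostVar,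
    hybPostVar]

variable {B w} {w' : RandomSource K B.N → ℝ}

theorem offMean_congr {i : Fin K} (h : ∀ n, w (.offline i n) = w' (.offline i n)) :
    B.offMean w i = B.offMean w' i := by
  simp [offMean, h]

theorem armIndex_congr {s : PullState K} {t : ℕ} {i : Fin K}
    (h : ∀ n, w (.offline i n) = w' (.offline i n)) (hon : w (.onNoise t i) = w' (.onNoise t i))
    (hhyb : w (.hybNoise t i) = w' (.hybNoise t i)) :
    B.armIndex w s t i = B.armIndex w' s t i := by
  simp [armIndex, onSample, hybSample, hybPostMean, offMean_congr h, hon, hhyb]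

/-- The state at the beginning of a round does not depend on the posterior noise of this and later
rounds. -/
theorem dependsOn_state (t : ℕ) :
    DependsOn (fun w ↦ B.state sel w t) (RandomSource.before t : Set (RandomSource K B.N)) := by
  induction t with
  | zero => intro w w' _; rfl
  | succ t ih =>
    intro (w : RandomSource K B.N → ℝ) (w' : RandomSource K B.N → ℝ) h
    have hs : B.state sel w t = B.state sel w' t := ih fun s hs ↦ h s <| by
      cases s with
      | offline => trivial
      | reward => trivial
      | onNoise t' j => exact Nat.lt_succ_of_lt hs
      | hybNoise t' j => exact Nat.lt_succ_of_lt hs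
    have hi : B.armIndex w (B.state sel w' t) t = B.armIndex w' (B.state sel w' t) t := by
      funext i
      exact armIndex_congr (fun n ↦ h (.offline i n) trivial)
        (h (.onNoise t i) (Nat.lt_succ_self t)) (h (.hybNoise t i) (Nat.lt_succ_self t))
    have hr : ∀ i n, w (.reward i n) = w' (.reward i n) := fun i n ↦ h (.reward i n) trivial
    simp only [state, hs, hi, hr]

/-- A reward that has not been revealed yet does not influence the state. -/
theorem state_congr_of_pulls_le {i : Fin K} {n t : ℕ} (h : ∀ s, s ≠ .reward i n → w s = w' s)
    (hn : (B.state sel w t).pulls i ≤ n) : B.state sel w t = B.state sel w' t := by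
  induction t with
  | zero => rfl
  | succ t ih =>
    have hs := ih ((B.pulls_mono sel w i t.le_succ).trans hn)
    have hi : B.armIndex w (B.state sel w' t) t = B.armIndex w' (B.state sel w' t) t := by
      funext j
      exact armIndex_congr (fun n ↦ h _ (by simp)) (h _ (by simp)) (h _ (by simp))
    have hr : w (.reward (sel t (B.armIndex w' (B.state sel w' t) t))
        ((B.state sel w' t).pulls (sel t (B.armIndex w' (B.state sel w' t) t)))) =
        w' (.reward (sel t (B.armIndex w' (B.state sel w' t) t))
        ((B.state sel w' t).pulls (sel t (B.armIndex w' (B.state sel w' t) t)))) := by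
      refine h _ fun he ↦ ?_
      rw [pulls_succ, action, hs, hi] at hn
      injection he with h1 h2
      rw [h1] at h2
      rw [if_pos h1] at hn
      omega
    simp only [state, hs, hi, hr]

theorem action_congr_of_pulls_le {i : Fin K} {n t : ℕ} (h : ∀ s, s ≠ .reward i n → w s = w' s)
    (hn : (B.state sel w t).pulls i ≤ n) : B.action sel w t = B.action sel w' t := by
  rw [action, action, state_congr_of_pulls_le sel h hn]
  congr 1
  funext j
  exact armIndex_congr (fun n ↦ h _ (by simp)) (h _ (by simp)) (h _ (by simp))

variable (B)

/-! ### Measurability of pull counts, indices and actions. -/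

section Measurability

theorem measurable_offMean (i : Fin K) : Measurable fun w ↦ B.offMean w i := by
  unfold offMean; fun_prop

theorem measurable_onMeanAt (i : Fin K) (k : ℕ) : Measurable fun w ↦ B.onMeanAt w i k := by
  unfold onMeanAt; fun_prop

theorem measurable_hybMeanAt (i : Fin K) (k : ℕ) : Measurable fun w ↦ B.hybMeanAt w i k := by
  have := B.measurable_offMean i
  unfold hybMeanAt
  split_ifs <;> fun_prop

theorem _root_.Measurable.comp_nat {Ω β : Type*} [MeasurableSpace Ω] [MeasurableSpace β]
    {f : ℕ → Ω → β} (hf : ∀ n, Measurable (f n)) {g : Ω → ℕ} (hg : Measurable g) :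
    Measurable fun w ↦ f (g w) w :=
  (measurable_from_prod_countable_right (f := fun p : ℕ × Ω ↦ f p.1 p.2) hf).comp
    (hg.prodMk measurable_id)

variable {sel}

theorem measurable_armIndex_of_pulls {t : ℕ}
    (h : ∀ i, Measurable fun w ↦ (B.state sel w t).pulls i) (i : Fin K) :
    Measurable fun w ↦ B.armIndex w (B.state sel w t) t i := by
  simp only [armIndex_state]
  have h1 := Measurable.comp_nat (B.measurable_onMeanAt i) (h i)
  have h2 := Measurable.comp_nat (B.measurable_hybMeanAt i) (h i)
  have h3 : Measurable fun w ↦ (((B.state sel w t).pulls i : ℕ) : ℝ) :=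
    (measurable_of_countable (Nat.cast : ℕ → ℝ)).comp (h i)
  exact measurable_median3.comp (h1.prodMk ((by fun_prop : Measurable _).prodMk (by fun_prop)))

theorem measurable_pulls (hsel : ∀ t, Measurable (sel t)) (t : ℕ) (i : Fin K) :
    Measurable fun w ↦ (B.state sel w t).pulls i := by
  induction t generalizing i with
  | zero => simp only [state]; exact measurable_const
  | succ t ih =>
    have ha : Measurable fun w ↦ B.action sel w t :=
      (hsel t).comp (measurable_pi_lambda _ fun i ↦ B.measurable_armIndex_of_pulls ih i)
    simp only [pulls_succ]
    exact (ih i).add (Measurable.ite (ha (measurableSet_singleton i)) measurable_const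
      measurable_const)

theorem measurable_armIndex (hsel : ∀ t, Measurable (sel t)) (t : ℕ) (i : Fin K) :
    Measurable fun w ↦ B.armIndex w (B.state sel w t) t i :=
  B.measurable_armIndex_of_pulls (B.measurable_pulls hsel t) i

theorem measurable_action (hsel : ∀ t, Measurable (sel t)) (t : ℕ) :
    Measurable fun w ↦ B.action sel w t :=
  (hsel t).comp (measurable_pi_lambda _ fun i ↦ B.measurable_armIndex hsel t i)

end Measurability

end

end OfflineOnlineBandit

namespace OfflineOnlineBandit

noncomputable section

variable {K : ℕ} (B : OfflineOnlineBandit K) {sel : ℕ → (Fin K → ℝ) → Fin K}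

instance : IsProbabilityMeasure B.prob := by unfold prob; infer_instance

theorem measurePreserving_source (s : RandomSource K B.N) :
    MeasurePreserving (fun w : RandomSource K B.N → ℝ ↦ w s) B.prob (B.sourceLaw s) :=
  measurePreserving_eval_infinitePi _ s

theorem iIndepFun_source :
    iIndepFun (fun (s : RandomSource K B.N) (w : RandomSource K B.N → ℝ) ↦ w s) B.prob :=
  iIndepFun_infinitePi (X := fun _ x ↦ x) fun _ ↦ measurable_id

theorem muOn_mem_Icc (i : Fin K) : B.muOn i ∈ Set.Icc (0 : ℝ) 1 := by
  have := B.onLaw_prob i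
  refine ⟨integral_nonneg_of_ae ((B.onLaw_supp i).mono fun x hx ↦ hx.1), ?_⟩
  have h := integral_mono_of_nonneg ((B.onLaw_supp i).mono fun x hx ↦ hx.1)
    (integrable_const (1 : ℝ)) ((B.onLaw_supp i).mono fun x hx ↦ hx.2)
  simpa [muOn] using h

theorem muOff_mem_Icc (i : Fin K) : B.muOff i ∈ Set.Icc (0 : ℝ) 1 := by
  have := B.offLaw_prob i
  refine ⟨integral_nonneg_of_ae ((B.offLaw_supp i).mono fun x hx ↦ hx.1), ?_⟩
  have h := integral_mono_of_nonneg ((B.offLaw_supp i).mono fun x hx ↦ hx.1)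
    (integrable_const (1 : ℝ)) ((B.offLaw_supp i).mono fun x hx ↦ hx.2)
  simpa [muOff] using h

/-! ### Regret decomposition. -/

section Regret

theorem ae_reward_mem_Icc (i : Fin K) (n : ℕ) :
    ∀ᵐ w ∂B.prob, w (.reward i n) ∈ Set.Icc (0 : ℝ) 1 :=
  (B.measurePreserving_source (.reward i n)).quasiMeasurePreserving.ae (B.onLaw_supp i)

theorem ae_offline_mem_Icc (i : Fin K) (n : Fin (B.N i)) :
    ∀ᵐ w ∂B.prob, w (.offline i n) ∈ Set.Icc (0 : ℝ) 1 :=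
  (B.measurePreserving_source (.offline i n)).quasiMeasurePreserving.ae (B.offLaw_supp i)

theorem integral_reward (i : Fin K) (n : ℕ) : ∫ w, w (.reward i n) ∂B.prob = B.muOn i := by
  have h := (B.measurePreserving_source (.reward i n))
  have h2 := integral_map (μ := B.prob) h.measurable.aemeasurable
    (f := fun x : ℝ ↦ x) (by fun_prop)
  rw [h.map_eq] at h2
  exact h2.symm

theorem integral_offline (i : Fin K) (n : Fin (B.N i)) :
    ∫ w, w (.offline i n) ∂B.prob = B.muOff i := by
  have h := (B.measurePreserving_source (.offline i n))
  have h2 := integral_map (μ := B.prob) h.measurable.aemeasurable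
    (f := fun x : ℝ ↦ x) (by fun_prop)
  rw [h.map_eq] at h2
  exact h2.symm

theorem integrable_reward (i : Fin K) (n : ℕ) :
    Integrable (fun w ↦ w (.reward i n)) B.prob :=
  Integrable.of_bound (measurable_pi_apply _).aestronglyMeasurable 1 ((B.ae_reward_mem_Icc i n).mono fun w hw ↦ by
    rw [Real.norm_eq_abs, abs_of_nonneg hw.1]; exact hw.2)

/-- The event that round `t` reveals the reward number `n` of arm `i`. -/
def revealSet (sel : ℕ → (Fin K → ℝ) → Fin K) (t : ℕ) (i : Fin K) (n : ℕ) :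
    Set (RandomSource K B.N → ℝ) :=
  {w | B.action sel w t = i ∧ (B.state sel w t).pulls i = n}

theorem measurableSet_action_eq (hsel : ∀ t, Measurable (sel t)) (t : ℕ) (i : Fin K) :
    MeasurableSet {w | B.action sel w t = i} :=
  B.measurable_action hsel t (measurableSet_singleton i)

theorem measurableSet_revealSet (hsel : ∀ t, Measurable (sel t)) (t : ℕ) (i : Fin K) (n : ℕ) :
    MeasurableSet (B.revealSet sel t i n) :=
  (B.measurableSet_action_eq hsel t i).inter
    (B.measurable_pulls hsel t i (measurableSet_singleton n))

theorem dependsOn_indicator_revealSet (t : ℕ) (i : Fin K) (n : ℕ) :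
    DependsOn ((B.revealSet sel t i n).indicator fun _ ↦ (1 : ℝ)) {.reward i n}ᶜ := by
  have key : ∀ w w' : RandomSource K B.N → ℝ, (∀ s, s ≠ .reward i n → w s = w' s) →
      w ∈ B.revealSet sel t i n → w' ∈ B.revealSet sel t i n := fun w w' h hw ↦ by
    rw [revealSet, Set.mem_ofPred_eq] at hw ⊢
    rwa [← action_congr_of_pulls_le sel h hw.2.le, ← state_congr_of_pulls_le sel h hw.2.le]
  intro w w' h
  have hiff : w ∈ B.revealSet sel t i n ↔ w' ∈ B.revealSet sel t i n :=
    ⟨key w w' fun s hs ↦ h s hs, key w' w fun s hs ↦ (h s hs).symm⟩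
  by_cases hw : w ∈ B.revealSet sel t i n
  · rw [Set.indicator_of_mem hw, Set.indicator_of_mem (hiff.1 hw)]
  · rw [Set.indicator_of_notMem hw, Set.indicator_of_notMem (mt hiff.2 hw)]

/-- Whether reward `n` is revealed in round `t` is decided without looking at that reward, so the
two are independent. This replaces a filtration argument. -/
theorem integral_revealSet_mul_reward (hsel : ∀ t, Measurable (sel t)) (t : ℕ) (i : Fin K)
    (n : ℕ) :
    ∫ w, (B.revealSet sel t i n).indicator (fun _ ↦ (1 : ℝ)) w * w (.reward i n) ∂B.prob =
      B.prob.real (B.revealSet sel t i n) * B.muOn i := by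
  have hm : Measurable ((B.revealSet sel t i n).indicator fun _ ↦ (1 : ℝ)) :=
    measurable_const.indicator (B.measurableSet_revealSet hsel t i n)
  have hind : IndepFun ((B.revealSet sel t i n).indicator fun _ ↦ (1 : ℝ))
      (fun w : RandomSource K B.N → ℝ ↦ w (.reward i n)) B.prob :=
    indepFun_infinitePi_of_dependsOn (t := {.reward i n}) hm (measurable_pi_apply _)
      (B.dependsOn_indicator_revealSet t i n) (fun w w' h ↦ h _ rfl) disjoint_compl_left
  rw [hind.integral_fun_mul_eq_mul_integral hm.aestronglyMeasurable
      (measurable_pi_apply _).aestronglyMeasurable,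
    integral_indicator_const _ (B.measurableSet_revealSet hsel t i n), B.integral_reward]
  simp

theorem obsReward_eq_sum (w : RandomSource K B.N → ℝ) (t : ℕ) :
    B.obsReward sel w t = ∑ i, ∑ n ∈ Finset.range (t + 1),
      (B.revealSet sel t i n).indicator (fun _ ↦ (1 : ℝ)) w * w (.reward i n) := by
  rw [Finset.sum_eq_single (B.action sel w t),
    Finset.sum_eq_single ((B.state sel w t).pulls (B.action sel w t))]
  · rw [Set.indicator_of_mem (by exact ⟨rfl, rfl⟩), one_mul, obsReward]
  · intro n _ hn
    rw [Set.indicator_of_notMem (fun h ↦ hn h.2.symm), zero_mul]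
  · intro h
    exact absurd (Finset.mem_range.2 (Nat.lt_succ_of_le (B.pulls_le sel w t _))) h
  · intro i _ hi
    exact Finset.sum_eq_zero fun n _ ↦ by
      rw [Set.indicator_of_notMem (fun h ↦ hi h.1.symm), zero_mul]
  · simp

theorem integrable_revealSet_mul_reward (hsel : ∀ t, Measurable (sel t)) (t : ℕ) (i : Fin K)
    (n : ℕ) :
    Integrable (fun w ↦ (B.revealSet sel t i n).indicator (fun _ ↦ (1 : ℝ)) w * w (.reward i n))
      B.prob := by
  refine ((B.integrable_reward i n).indicator (B.measurableSet_revealSet hsel t i n)).congr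
    (ae_of_all _ fun w ↦ ?_)
  by_cases h : w ∈ B.revealSet sel t i n <;> simp [h]

theorem sum_measureReal_revealSet (hsel : ∀ t, Measurable (sel t)) (t : ℕ) (i : Fin K) :
    ∑ n ∈ Finset.range (t + 1), B.prob.real (B.revealSet sel t i n) =
      B.prob.real {w | B.action sel w t = i} := by
  rw [← measureReal_biUnion_finset]
  · congr 1
    ext w
    simp only [revealSet, Set.mem_iUnion, Finset.mem_range, Set.mem_ofPred_eq, exists_prop]
    exact ⟨fun ⟨_, _, h, _⟩ ↦ h,
      fun h ↦ ⟨_, Nat.lt_succ_of_le (B.pulls_le sel w t i), h, rfl⟩⟩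
  · intro n _ m _ hnm
    exact Set.disjoint_left.2 fun w hn hm ↦ hnm (hn.2.symm.trans hm.2)
  · exact fun n _ ↦ B.measurableSet_revealSet hsel t i n

theorem integral_obsReward (hsel : ∀ t, Measurable (sel t)) (t : ℕ) :
    ∫ w, B.obsReward sel w t ∂B.prob =
      ∑ i, B.prob.real {w | B.action sel w t = i} * B.muOn i := by
  simp only [obsReward_eq_sum]
  rw [integral_finsetSum _ fun i _ ↦ integrable_finsetSum _ fun n _ ↦
    B.integrable_revealSet_mul_reward hsel t i n]
  refine Finset.sum_congr rfl fun i _ ↦ ?_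
  rw [integral_finsetSum _ fun n _ ↦ B.integrable_revealSet_mul_reward hsel t i n,
    ← B.sum_measureReal_revealSet hsel, Finset.sum_mul]
  exact Finset.sum_congr rfl fun n _ ↦ B.integral_revealSet_mul_reward hsel t i n

theorem integrable_obsReward (hsel : ∀ t, Measurable (sel t)) (t : ℕ) :
    Integrable (fun w ↦ B.obsReward sel w t) B.prob := by
  simp only [obsReward_eq_sum]
  exact integrable_finsetSum _ fun i _ ↦ integrable_finsetSum _ fun n _ ↦
    B.integrable_revealSet_mul_reward hsel t i n

theorem sum_measureReal_action (hsel : ∀ t, Measurable (sel t)) (t : ℕ) :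
    ∑ i, B.prob.real {w | B.action sel w t = i} = 1 := by
  rw [← measureReal_biUnion_finset]
  · have : (⋃ i ∈ (Finset.univ : Finset (Fin K)), {w | B.action sel w t = i}) = Set.univ := by
      ext w; simp
    rw [this]
    simp
  · intro i _ j _ hij
    exact Set.disjoint_left.2 fun w hi hj ↦ hij (hi.symm.trans hj)
  · exact fun i _ ↦ B.measurableSet_action_eq hsel t i

/-- The regret is the sum of the gaps weighted by the expected numbers of pulls. -/
theorem regret_eq_sum_gap_mul (hsel : ∀ t, Measurable (sel t)) (best : Fin K) (T : ℕ) :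
    B.regret best sel T = ∑ i ∈ Finset.univ.erase best, B.gap best i *
      ∑ t ∈ Finset.range T, B.prob.real {w | B.action sel w t = i} := by
  rw [Finset.sum_erase _ (by simp [gap]), regret,
    integral_finsetSum _ fun t _ ↦ B.integrable_obsReward hsel t]
  simp only [integral_obsReward B hsel, gap, Finset.mul_sum]
  rw [Finset.sum_comm (s := Finset.univ)]
  have : (T : ℝ) * B.muOn best = ∑ t ∈ Finset.range T, B.muOn best := by simp
  rw [this, ← Finset.sum_sub_distrib]
  refine Finset.sum_congr rfl fun t _ ↦ ?_
  simp only [sub_mul, Finset.sum_sub_distrib, ← Finset.mul_sum, B.sum_measureReal_action hsel t,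
    mul_one]
  simp only [mul_comm]

end Regret

/-! ### Sub-Gaussian concentration of reward sums. -/

section Concentration

/-- Centered sum of the first `k` rewards of arm `i`. -/
def onDev (i : Fin K) (k : ℕ) (w : RandomSource K B.N → ℝ) : ℝ :=
  ∑ n ∈ Finset.range k, (w (.reward i n) - B.muOn i)

/-- Centered sum of the first `k` rewards and of all offline samples of arm `i`. -/
def hybDev (i : Fin K) (k : ℕ) (w : RandomSource K B.N → ℝ) : ℝ :=
  B.onDev i k w + ∑ n : Fin (B.N i), (w (.offline i n) - B.muOff i)

theorem measurable_onDev (i : Fin K) (k : ℕ) : Measurable (B.onDev i k) := by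
  unfold onDev; fun_prop

theorem measurable_hybDev (i : Fin K) (k : ℕ) : Measurable (B.hybDev i k) := by
  have := B.measurable_onDev i k
  unfold hybDev; fun_prop

theorem hasSubgaussianMGF_reward (i : Fin K) (n : ℕ) :
    HasSubgaussianMGF (fun w ↦ w (.reward i n) - B.muOn i) (1 / 4) B.prob := by
  have h := hasSubgaussianMGF_of_mem_Icc (μ := B.prob) (measurable_pi_apply _).aemeasurable
    (B.ae_reward_mem_Icc i n)
  rw [B.integral_reward] at h
  convert h using 1
  norm_num

theorem hasSubgaussianMGF_offline (i : Fin K) (n : Fin (B.N i)) :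
    HasSubgaussianMGF (fun w ↦ w (.offline i n) - B.muOff i) (1 / 4) B.prob := by
  have h := hasSubgaussianMGF_of_mem_Icc (μ := B.prob) (measurable_pi_apply _).aemeasurable
    (B.ae_offline_mem_Icc i n)
  rw [B.integral_offline] at h
  convert h using 1
  norm_num

theorem hasSubgaussianMGF_onDev (i : Fin K) (k : ℕ) :
    HasSubgaussianMGF (B.onDev i k) (k * (1 / 4)) B.prob := by
  have hind : iIndepFun (fun (n : ℕ) (w : RandomSource K B.N → ℝ) ↦
      w (.reward i n) - B.muOn i) B.prob :=
    (B.iIndepFun_source.precomp (g := fun n : ℕ ↦ RandomSource.reward i n)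
      fun a b h ↦ by injection h).comp (fun _ x ↦ x - B.muOn i) fun _ ↦ by fun_prop
  have h := HasSubgaussianMGF.sum_of_iIndepFun hind (s := Finset.range k)
    fun n _ ↦ B.hasSubgaussianMGF_reward i n
  rw [Finset.sum_const, Finset.card_range, nsmul_eq_mul] at h
  exact h

theorem hasSubgaussianMGF_hybDev (i : Fin K) (k : ℕ) :
    HasSubgaussianMGF (B.hybDev i k) ((k + B.N i) * (1 / 4)) B.prob := by
  have hind : iIndepFun (fun (n : Fin (B.N i)) (w : RandomSource K B.N → ℝ) ↦
      w (.offline i n) - B.muOff i) B.prob :=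
    (B.iIndepFun_source.precomp (g := fun n : Fin (B.N i) ↦ RandomSource.offline i n)
      fun a b h ↦ by injection h with h1 h2).comp (fun _ x ↦ x - B.muOff i) fun _ ↦ by fun_prop
  have h := HasSubgaussianMGF.sum_of_iIndepFun hind (s := Finset.univ)
    fun n _ ↦ B.hasSubgaussianMGF_offline i n
  have h2 : IndepFun (B.onDev i k)
      (fun w ↦ ∑ n : Fin (B.N i), (w (.offline i n) - B.muOff i)) B.prob := by
    refine indepFun_infinitePi_of_dependsOn (s := Set.range fun n ↦ .reward i n)
      (t := Set.range fun n ↦ .offline i n) (B.measurable_onDev i k) (by fun_prop) ?_ ?_ ?_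
    · intro w w' h
      exact Finset.sum_congr rfl fun n _ ↦ by rw [h _ ⟨n, rfl⟩]
    · intro w w' h
      exact Finset.sum_congr rfl fun n _ ↦ by rw [h _ ⟨n, rfl⟩]
    · rw [Set.disjoint_left]
      rintro _ ⟨n, rfl⟩ ⟨m, hm⟩
      simp at hm
  have h3 := (B.hasSubgaussianMGF_onDev i k).add_of_indepFun h h2
  rw [Finset.sum_const, Finset.card_univ, Fintype.card_fin, nsmul_eq_mul, ← add_mul] at h3
  exact h3

theorem measure_onDev_ge_le (i : Fin K) (k : ℕ) {ε : ℝ} (hε : 0 ≤ ε) :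
    B.prob {w | k * ε ≤ B.onDev i k w} ≤ ENNReal.ofReal (Real.exp (-(2 * ε ^ 2 * k))) := by
  have h := (B.hasSubgaussianMGF_onDev i k).measure_ge_le (ε := k * ε) (by positivity)
  rw [← ofReal_measureReal]
  refine ENNReal.ofReal_le_ofReal (h.trans (Real.exp_le_exp.2 (le_of_eq ?_)))
  rcases Nat.eq_zero_or_pos k with rfl | hk
  · simp
  · push_cast
    field_simp
    norm_num

/-- The Hoeffding exponent is `2ε²(k + N_i)`; the offline part is dropped, as the bound only has to
be summable in `k`. -/
theorem measure_hybDev_ge_le (i : Fin K) (k : ℕ) {ε : ℝ} (hε : 0 ≤ ε) :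
    B.prob {w | (k + B.N i) * ε ≤ B.hybDev i k w} ≤
      ENNReal.ofReal (Real.exp (-(2 * ε ^ 2 * k))) := by
  have h := (B.hasSubgaussianMGF_hybDev i k).measure_ge_le (ε := (k + B.N i) * ε) (by positivity)
  rw [← ofReal_measureReal]
  refine ENNReal.ofReal_le_ofReal (h.trans (Real.exp_le_exp.2 ?_))
  have hN : (0 : ℝ) ≤ B.N i := by positivity
  rcases Nat.eq_zero_or_pos k with rfl | hk
  · simp only [CharP.cast_eq_zero, mul_zero, neg_zero]
    exact div_nonpos_of_nonpos_of_nonneg (by nlinarith [sq_nonneg ((0 + (B.N i : ℝ)) * ε)])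
      (by positivity)
  · have hk' : (0 : ℝ) < k := by exact_mod_cast hk
    push_cast
    rw [div_le_iff₀ (by positivity)]
    nlinarith [mul_nonneg (mul_nonneg (sq_nonneg ε) hN) (add_nonneg hk'.le hN)]

theorem sum_reward_eq (w : RandomSource K B.N → ℝ) (i : Fin K) (k : ℕ) :
    ∑ n ∈ Finset.range k, w (.reward i n) = B.onDev i k w + k * B.muOn i := by
  simp [onDev, Finset.sum_sub_distrib]

theorem N_mul_offMean_eq (w : RandomSource K B.N → ℝ) (i : Fin K) :
    (B.N i : ℝ) * B.offMean w i = ∑ n : Fin (B.N i), w (.offline i n) := by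
  rw [offMean]
  rcases Nat.eq_zero_or_pos (B.N i) with h | h
  · have : IsEmpty (Fin (B.N i)) := by rw [h]; infer_instance
    simp [h]
  · field_simp

theorem sum_reward_add_offMean_eq (w : RandomSource K B.N → ℝ) (i : Fin K) (k : ℕ) :
    ∑ n ∈ Finset.range k, w (.reward i n) + (B.N i : ℝ) * B.offMean w i =
      B.hybDev i k w + k * B.muOn i + B.N i * B.muOff i := by
  rw [sum_reward_eq, N_mul_offMean_eq, hybDev]
  simp [Finset.sum_sub_distrib]
  ring

end Concentration

end

end OfflineOnlineBandit

/-! ### Deterministic estimates for geometric sums and odds. -/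

theorem sum_range_exp_neg_mul_le {c : ℝ} (hc : 0 < c) (T : ℕ) :
    ∑ k ∈ Finset.range T, Real.exp (-(c * k)) ≤ 1 + 1 / c := by
  have h1 : ∀ k : ℕ, Real.exp (-(c * k)) = Real.exp (-c) ^ k := fun k ↦ by
    rw [← Real.exp_nat_mul]; ring_nf
  simp only [h1]
  have hlt : Real.exp (-c) < 1 := by rw [Real.exp_lt_one_iff]; linarith
  have hle : Real.exp (-c) ≤ 1 / (1 + c) := by
    rw [Real.exp_neg, one_div]
    exact inv_anti₀ (by linarith) (by linarith [Real.add_one_le_exp c])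
  calc ∑ k ∈ Finset.range T, Real.exp (-c) ^ k
      ≤ ∑' k : ℕ, Real.exp (-c) ^ k :=
        (summable_geometric_of_lt_one (Real.exp_pos _).le hlt).sum_le_tsum _
          fun _ _ ↦ by positivity
    _ = (1 - Real.exp (-c))⁻¹ := tsum_geometric_of_lt_one (Real.exp_pos _).le hlt
    _ ≤ (1 - 1 / (1 + c))⁻¹ := by
        refine inv_anti₀ ?_ (by linarith)
        rw [sub_pos, div_lt_one (by linarith)]; linarith
    _ = 1 + 1 / c := by
        have h2 : 1 - 1 / (1 + c) = c / (1 + c) := by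
          have : 1 + c ≠ 0 := by positivity
          field_simp
          ring
        rw [h2, inv_div, add_div, div_self hc.ne', add_comm]

/-- The exponent `(x + 2)² / 2` has a linear term, absorbed by raising the coefficient of `x²` from
`1/2` to `3/4`. -/
theorem invTailBound_le_of_le {a x : ℝ} (h : a ≤ 1 + x) :
    invTailBound a ≤ 3 * Real.exp (6 + 3 / 4 * x ^ 2) := by
  unfold invTailBound
  have h0 : max a 0 ≤ 1 + max x 0 := max_le (h.trans (by gcongr; exact le_max_left _ _))
    (by positivity)
  have h1 : max x 0 ^ 2 ≤ x ^ 2 := by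
    rcases le_total x 0 with hx | hx
    · rw [max_eq_right hx]; nlinarith
    · rw [max_eq_left hx]
  have h2 : (max a 0 + 1) ^ 2 ≤ (max x 0 + 2) ^ 2 := by
    have : 0 ≤ max a 0 := le_max_right _ _
    exact pow_le_pow_left₀ (by linarith) (by linarith) 2
  gcongr
  nlinarith [sq_nonneg (max x 0 / 2 - 2)]

/-- The decay in `c` is explicit if the anchor clears the level. Otherwise `-c < a ≤ 1 + x - 2c`
forces `c < 1 + x`, so a large `c` needs a large deviation `x`, and `exp(-c²/20)` is bought by
raising the coefficient of `x²` from `3/4` to `17/20`. Separating `x` from `z` doubles the latter to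
`17/10`. -/
theorem oddsBound_le_of_le {c a b x z : ℝ} (hc : 0 ≤ c) (ha : a ≤ 1 + x - 2 * c)
    (hb : b ≤ 1 + z) :
    oddsBound c a b ≤ 9 * Real.exp 13 * Real.exp (-(c ^ 2 / 20)) *
      (Real.exp (17 / 10 * x ^ 2) + Real.exp (17 / 10 * z ^ 2)) := by
  have key : ∀ u v : ℝ, Real.exp (u + v) ≤ Real.exp (2 * u) + Real.exp (2 * v) := fun u v ↦ by
    rw [Real.exp_add, two_mul, two_mul, Real.exp_add, Real.exp_add]
    nlinarith [sq_nonneg (Real.exp u - Real.exp v), sq_nonneg (Real.exp u),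
      sq_nonneg (Real.exp v)]
  have hx0 : 1 ≤ Real.exp (17 / 10 * x ^ 2) := Real.one_le_exp (by positivity)
  have hz0 : 0 < Real.exp (17 / 10 * z ^ 2) := Real.exp_pos _
  unfold oddsBound
  split_ifs with hac
  · have h1 : invTailBound a ≤ 3 * Real.exp 6 := by
      have := invTailBound_le_of_le (a := a) (x := 0) (by linarith)
      simpa using this
    calc Real.exp (-c ^ 2 / 2) * invTailBound a
        ≤ Real.exp (-(c ^ 2 / 20)) * (9 * Real.exp 13) := by
          have h2 : 3 * Real.exp 6 ≤ 9 * Real.exp 13 := by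
            have : Real.exp 6 ≤ Real.exp 13 := Real.exp_le_exp.2 (by norm_num)
            linarith [Real.exp_pos 6]
          refine mul_le_mul (Real.exp_le_exp.2 (by nlinarith [sq_nonneg c])) (h1.trans h2)
            (invTailBound_pos a).le (Real.exp_pos _).le
      _ = 9 * Real.exp 13 * Real.exp (-(c ^ 2 / 20)) * 1 := by ring
      _ ≤ _ := by gcongr; linarith
  · have h1 := invTailBound_le_of_le (a := a) (x := x) (by linarith)
    have h2 := invTailBound_le_of_le hb
    have hcx : c ^ 2 ≤ 2 + 2 * x ^ 2 := by
      have : c ≤ 1 + x := by linarith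
      nlinarith [sq_nonneg (1 - x)]
    calc invTailBound a * invTailBound b
        ≤ (3 * Real.exp (6 + 3 / 4 * x ^ 2)) * (3 * Real.exp (6 + 3 / 4 * z ^ 2)) :=
          mul_le_mul h1 h2 (invTailBound_pos b).le (by positivity)
      _ = 9 * Real.exp (12 + 3 / 4 * x ^ 2 + 3 / 4 * z ^ 2) := by
          rw [show (3 : ℝ) * Real.exp (6 + 3 / 4 * x ^ 2) * (3 * Real.exp (6 + 3 / 4 * z ^ 2)) =
            9 * (Real.exp (6 + 3 / 4 * x ^ 2) * Real.exp (6 + 3 / 4 * z ^ 2)) by ring,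
            ← Real.exp_add]
          ring_nf
      _ ≤ 9 * Real.exp (13 + -(c ^ 2 / 20) + (17 / 20 * x ^ 2 + 17 / 20 * z ^ 2)) := by
          refine mul_le_mul_of_nonneg_left (Real.exp_le_exp.2 ?_) (by norm_num)
          nlinarith [sq_nonneg z, sq_nonneg x]
      _ = 9 * Real.exp 13 * Real.exp (-(c ^ 2 / 20)) *
          Real.exp (17 / 20 * x ^ 2 + 17 / 20 * z ^ 2) := by
          rw [Real.exp_add, Real.exp_add]; ring
      _ ≤ _ := by
          gcongr
          refine (key _ _).trans (le_of_eq ?_)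
          ring_nf

namespace OfflineOnlineBandit

noncomputable section

variable {K : ℕ} (B : OfflineOnlineBandit K) {sel : ℕ → (Fin K → ℝ) → Fin K}

/-! ### Rounds in which the best arm is underestimated. -/

section Underestimation

/-- Bound for the odds of the index of arm `i` to fall below `y` after `k` pulls. -/
def oddsAt (i : Fin K) (y δ : ℝ) (k : ℕ) (w : RandomSource K B.N → ℝ) : ℝ :=
  oddsBound (δ * √((k : ℝ) + 1)) ((y - B.onMeanAt w i k) / √(1 / ((k : ℝ) + 1)))
    ((y - B.hybMeanAt w i k) / √(1 / ((k : ℝ) + (B.N i : ℝ) + 1)))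

theorem measurable_oddsAt (i : Fin K) (y δ : ℝ) (k : ℕ) : Measurable (B.oddsAt i y δ k) := by
  have h1 := B.measurable_onMeanAt i k
  have h2 := B.measurable_hybMeanAt i k
  exact (measurable_oddsBound _).comp
    ((by fun_prop : Measurable fun w ↦ (y - B.onMeanAt w i k) / √(1 / ((k : ℝ) + 1))).prodMk
      (by fun_prop))

/-- Rounds that pull a suboptimal arm of small index are paid for by the odds of the best arm at
its own pulls. -/
theorem measure_action_index_le (hsel : ∀ t, Measurable (sel t))
    (hmax : ∀ (t : ℕ) (v : Fin K → ℝ) (j : Fin K), v j ≤ v (sel t v)) (best i : Fin K) (y : ℝ) {δ : ℝ} (hδ : 0 < δ) (t : ℕ) :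
    B.prob {w | B.action sel w t = i ∧ B.armIndex w (B.state sel w t) t i ≤ y} ≤
      ∫⁻ w, (if B.action sel w t = best then
        ENNReal.ofReal (B.oddsAt best y δ ((B.state sel w t).pulls best) w) else 0) ∂B.prob := by
  classical
  let N₀ : Set (RandomSource K B.N) := {.onNoise t best, .hybNoise t best}
  -- Erasing the two noises of the best arm in round `t` represents "everything else" as a function
  -- independent of `Z`. The state and the indices of the other arms survive the erasure.
  let U : (RandomSource K B.N → ℝ) → RandomSource K B.N → ℝ := fun w s ↦ if s ∈ N₀ then 0 else w s
  let Z : (RandomSource K B.N → ℝ) → ℝ × ℝ := fun w ↦ (w (.onNoise t best), w (.hybNoise t best))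
  have hU : Measurable U := measurable_pi_lambda _ fun s ↦ by
    by_cases hs : s ∈ N₀
    · simp only [U, hs, if_true]; exact measurable_const
    · simp only [U, hs, if_false]; exact measurable_pi_apply s
  have hZ : Measurable Z := (measurable_pi_apply _).prodMk (measurable_pi_apply _)
  have hUZ : IndepFun U Z B.prob := by
    refine indepFun_infinitePi_of_dependsOn (s := N₀ᶜ) (t := N₀) hU hZ ?_ ?_ disjoint_compl_left
    · intro w w' h
      funext s
      by_cases hs : s ∈ N₀
      · simp [U, hs]
      · simp only [U, hs, if_false]; exact h s hs
    · intro w w' h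
      exact Prod.ext (h _ (by simp [N₀])) (h _ (by simp [N₀]))
  have hlaw : B.prob.map Z = (gaussianReal 0 1).prod (gaussianReal 0 1) :=
    Measure.infinitePi_map_eval_prod (P := B.sourceLaw) (by simp)
  have hUN : ∀ w s, s ∉ N₀ → U w s = w s := fun w s hs ↦ by simp [U, hs]
  have hstate : ∀ w, B.state sel (U w) t = B.state sel w t := fun w ↦
    B.dependsOn_state sel t fun s hs ↦ hUN w s <| by
      rintro (rfl | rfl)
      · exact absurd hs (lt_irrefl t)
      · exact absurd hs (lt_irrefl t)
  have hon : ∀ w k, B.onMeanAt (U w) best k = B.onMeanAt w best k := fun w k ↦ by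
    simp [onMeanAt, U, N₀]
  have hoff : ∀ w j, B.offMean (U w) j = B.offMean w j := fun w j ↦ by
    simp [offMean, U, N₀]
  have hhyb : ∀ w k, B.hybMeanAt (U w) best k = B.hybMeanAt w best k := fun w k ↦ by
    simp only [hybMeanAt, hoff]
    simp [U, N₀]
  have hodds : ∀ w k, B.oddsAt best y δ k (U w) = B.oddsAt best y δ k w := fun w k ↦ by
    rw [oddsAt, oddsAt, hon, hhyb]
  let kk : (RandomSource K B.N → ℝ) → ℕ := fun u ↦ (B.state sel u t).pulls best
  have hkk : Measurable kk := B.measurable_pulls hsel t best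
  let idx : (RandomSource K B.N → ℝ) × (ℝ × ℝ) → ℝ := fun p ↦
    median3 (B.onMeanAt p.1 best (kk p.1))
      (B.onMeanAt p.1 best (kk p.1) + √(1 / ((kk p.1 : ℝ) + 1)) * p.2.1)
      (B.hybMeanAt p.1 best (kk p.1) + √(1 / ((kk p.1 : ℝ) + (B.N best : ℝ) + 1)) * p.2.2)
  have hidx_eq : ∀ w, idx (U w, Z w) = B.armIndex w (B.state sel w t) t best := fun w ↦ by
    simp only [idx, kk, hstate, hon, hhyb, Z, armIndex_state]
  have hidx : Measurable idx := by
    have h1 := (Measurable.comp_nat (B.measurable_onMeanAt best) hkk).comp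
      (measurable_fst : Measurable (Prod.fst : (RandomSource K B.N → ℝ) × (ℝ × ℝ) → _))
    have h2 := (Measurable.comp_nat (B.measurable_hybMeanAt best) hkk).comp
      (measurable_fst : Measurable (Prod.fst : (RandomSource K B.N → ℝ) × (ℝ × ℝ) → _))
    have h3 : Measurable fun p : (RandomSource K B.N → ℝ) × (ℝ × ℝ) ↦ (kk p.1 : ℝ) :=
      (measurable_of_countable (Nat.cast : ℕ → ℝ)).comp (hkk.comp measurable_fst)
    simp only [Function.comp_def] at h1 h2
    exact measurable_median3.comp (h1.prodMk ((by fun_prop : Measurable _).prodMk (by fun_prop)))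
  let A : Set ((RandomSource K B.N → ℝ) × (ℝ × ℝ)) := {p | idx p ≤ y}
  let G : Set (RandomSource K B.N → ℝ) :=
    {u | ∀ j, j ≠ best → B.armIndex u (B.state sel u t) t j ≤ y}
  have hG : MeasurableSet G := by
    simp only [G, Set.ofPred_forall]
    exact MeasurableSet.iInter fun j ↦ MeasurableSet.iInter fun _ ↦
      measurableSet_le (B.measurable_armIndex hsel t j) measurable_const
  have hGU : ∀ w, U w ∈ G ↔ ∀ j, j ≠ best → B.armIndex w (B.state sel w t) t j ≤ y := fun w ↦ by
    refine forall₂_congr fun j hj ↦ ?_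
    rw [hstate, armIndex_congr (w := U w) (w' := w) (fun n ↦ hUN w _ (by simp [N₀]))
      (hUN w _ (by simp [N₀, hj])) (hUN w _ (by simp [N₀, hj]))]
  have hr : Measurable fun u ↦ ENNReal.ofReal (B.oddsAt best y δ (kk u) u) :=
    (Measurable.comp_nat (B.measurable_oddsAt best y δ) hkk).ennreal_ofReal
  have h := hUZ.measure_inter_le_lintegral hU hZ (A := A) (measurableSet_le hidx measurable_const)
    hG hr fun u ↦ by
      rw [hlaw]
      simp only [A, idx, Set.mem_ofPred_eq, not_le, oddsAt]
      exact measure_median3_le_le_oddsBound_mul (by positivity) (by positivity) (by positivity)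
  refine (measure_mono ?_).trans (h.trans (lintegral_mono fun w ↦ ?_))
  · rintro w ⟨ha, hy⟩
    have hall : ∀ j, B.armIndex w (B.state sel w t) t j ≤ y := fun j ↦ by
      have := hmax t (B.armIndex w (B.state sel w t) t) j
      rw [show sel t (B.armIndex w (B.state sel w t) t) = i from ha] at this
      exact this.trans hy
    refine ⟨(hGU w).2 fun j _ ↦ hall j, ?_⟩
    change idx (U w, Z w) ≤ y
    rw [hidx_eq]
    exact hall best
  · refine Set.indicator_apply_le' (fun hw ↦ ?_) fun _ ↦ zero_le
    have hbest : B.action sel w t = best := by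
      -- The other indices are at most `y` and the best one is strictly above it, so tie-breaking
      -- plays no role.
      by_contra hne
      have h1 : y < B.armIndex w (B.state sel w t) t best := by
        rw [← hidx_eq]; exact not_le.1 hw.2
      have h2 := hmax t (B.armIndex w (B.state sel w t) t) best
      exact absurd ((hGU w).1 hw.1 _ hne) (not_le.2 (h1.trans_le h2))
    rw [if_pos hbest, hodds]
    simp only [kk, hstate]
    exact le_rfl

theorem sum_measure_action_index_le (hsel : ∀ t, Measurable (sel t))
    (hmax : ∀ (t : ℕ) (v : Fin K → ℝ) (j : Fin K), v j ≤ v (sel t v)) (best i : Fin K) (y : ℝ) {δ : ℝ} (hδ : 0 < δ) (T : ℕ) :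
    ∑ t ∈ Finset.range T,
        B.prob {w | B.action sel w t = i ∧ B.armIndex w (B.state sel w t) t i ≤ y} ≤
      ∑ k ∈ Finset.range T, ∫⁻ w, ENNReal.ofReal (B.oddsAt best y δ k w) ∂B.prob := by
  have hm : ∀ t, Measurable fun w ↦ if B.action sel w t = best then
      ENNReal.ofReal (B.oddsAt best y δ ((B.state sel w t).pulls best) w) else 0 := fun t ↦
    Measurable.ite (B.measurableSet_action_eq hsel t best)
      (Measurable.comp_nat (B.measurable_oddsAt best y δ)
        (B.measurable_pulls hsel t best)).ennreal_ofReal measurable_const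
  refine (Finset.sum_le_sum fun t _ ↦
    B.measure_action_index_le hsel hmax best i y hδ t).trans ?_
  rw [← lintegral_finsetSum _ fun t _ ↦ hm t,
    ← lintegral_finsetSum _ fun k _ ↦ (B.measurable_oddsAt best y δ k).ennreal_ofReal]
  refine lintegral_mono fun w ↦ ?_
  simp only
  rw [B.sum_range_action_eq sel w (fun k ↦ ENNReal.ofReal (B.oddsAt best y δ k w)) best T]
  exact Finset.sum_le_sum_of_subset (Finset.range_mono (B.pulls_le sel w T best))

/-- The summand `1` pays for the `+ 1` in the denominator of the posterior mean: that bias is `μ/(k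
+ 1)`, hence at most `1` after scaling by `√(k + 1)`. -/
theorem onMean_standardized_le (i : Fin K) (k : ℕ) (w : RandomSource K B.N → ℝ) (δ : ℝ) :
    (B.muOn i - 2 * δ - B.onMeanAt w i k) / √(1 / ((k : ℝ) + 1)) ≤
      1 + -(B.onDev i k w) / √((k : ℝ) + 1) - 2 * (δ * √((k : ℝ) + 1)) := by
  have hk : (0 : ℝ) < (k : ℝ) + 1 := by positivity
  set q := √((k : ℝ) + 1) with hq
  have hq1 : 1 ≤ q := by rw [hq, Real.one_le_sqrt]; linarith [(Nat.cast_nonneg k : (0 : ℝ) ≤ k)]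
  have hqq : (k : ℝ) + 1 = q ^ 2 := by rw [hq, Real.sq_sqrt hk.le]
  have hq0 : 0 < q := by linarith
  rw [Real.sqrt_div zero_le_one, Real.sqrt_one, ← hq, onMeanAt, sum_reward_eq, hqq]
  have hkq : (k : ℝ) = q ^ 2 - 1 := by linarith
  rw [hkq]
  have hmu := (B.muOn_mem_Icc i).2
  have hdiff : (B.muOn i - 2 * δ - (B.onDev i k w + (q ^ 2 - 1) * B.muOn i) / q ^ 2) / (1 / q) =
      B.muOn i / q + -(B.onDev i k w) / q - 2 * (δ * q) := by
    field_simp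
    ring
  rw [hdiff]
  have : B.muOn i / q ≤ 1 := by rw [div_le_one hq0]; linarith
  linarith

theorem le_V (i : Fin K) : B.muOn i - B.muOff i ≤ B.V i := by
  have h := (abs_le.1 (B.shift_le i)).1
  simp only [muOn, muOff]
  linarith

/-- The right shift compensates any downward bias of the offline data, since `V_i ≥ μ_on - μ_off`;
only the regularization and the centered sum remain. Nonnegative offline samples are needed at `k =
0`, where the hybrid mean is not regularized. -/
theorem hybMean_standardized_le (i : Fin K) (k : ℕ) {w : RandomSource K B.N → ℝ}
    (hw : ∀ n, 0 ≤ w (.offline i n)) {δ : ℝ} (hδ : 0 ≤ δ) :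
    (B.muOn i - 2 * δ - B.hybMeanAt w i k) / √(1 / ((k : ℝ) + (B.N i : ℝ) + 1)) ≤
      1 + -(B.hybDev i k w) / √((k : ℝ) + (B.N i : ℝ) + 1) := by
  have hk0 : (0 : ℝ) ≤ k := Nat.cast_nonneg k
  have hN0 : (0 : ℝ) ≤ B.N i := Nat.cast_nonneg _
  have hk : (0 : ℝ) < (k : ℝ) + (B.N i : ℝ) + 1 := by positivity
  set q := √((k : ℝ) + (B.N i : ℝ) + 1) with hq
  have hq1 : 1 ≤ q := by rw [hq, Real.one_le_sqrt]; linarith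
  have hqq : (k : ℝ) + (B.N i : ℝ) + 1 = q ^ 2 := by rw [hq, Real.sq_sqrt hk.le]
  have hq0 : 0 < q := by linarith
  have hmu := B.muOn_mem_Icc i
  have hmuf := B.muOff_mem_Icc i
  have hV := B.le_V i
  have hV0 := B.V_nonneg i
  rw [Real.sqrt_div zero_le_one, Real.sqrt_one, ← hq, div_div_eq_mul_div, div_one]
  suffices h : (B.muOn i - B.hybMeanAt w i k) * q ^ 2 ≤ q + -(B.hybDev i k w) by
    have h' : (B.muOn i - 2 * δ - B.hybMeanAt w i k) * q * q ≤
        (1 + -(B.hybDev i k w) / q) * q := by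
      have : (1 + -(B.hybDev i k w) / q) * q = q + -(B.hybDev i k w) := by field_simp
      rw [this]
      nlinarith [mul_nonneg hδ (sq_nonneg q)]
    exact le_of_mul_le_mul_right h' hq0
  rw [← hqq, hybMeanAt]
  have hsum := B.sum_reward_add_offMean_eq w i k
  split_ifs with hk1
  · subst hk1
    simp only [Finset.range_zero, Finset.sum_empty, zero_add, Nat.cast_zero, zero_mul,
      add_zero] at hsum ⊢
    have hoff : 0 ≤ B.offMean w i := div_nonneg (Finset.sum_nonneg fun n _ ↦ hw n) hN0
    nlinarith [mul_le_mul_of_nonneg_left hV hN0, hmu.2]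
  · have hn : (0 : ℝ) < (k : ℝ) + (B.N i : ℝ) := by
      have : (0 : ℝ) < k := by exact_mod_cast Nat.pos_of_ne_zero hk1
      linarith
    rw [hsum]
    have h1 : (B.N i : ℝ) * B.V i ≤ (B.N i : ℝ) * B.V i / ((k : ℝ) + (B.N i : ℝ)) *
        ((k : ℝ) + (B.N i : ℝ) + 1) := by
      rw [div_mul_eq_mul_div, le_div_iff₀ hn]
      nlinarith [mul_nonneg hN0 hV0]
    have h2 : (B.hybDev i k w + k * B.muOn i + B.N i * B.muOff i) / ((k : ℝ) + (B.N i : ℝ) + 1) *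
        ((k : ℝ) + (B.N i : ℝ) + 1) = B.hybDev i k w + k * B.muOn i + B.N i * B.muOff i := by
      field_simp
    have h3 := mul_le_mul_of_nonneg_left hV hN0
    rw [sub_mul, add_mul, h2]
    nlinarith [hmu.2]

/-- The standardized sums have variance proxy at most `1/4`, and `17/10 · 1/4 = 17/40` stays below
the threshold `9/20`, so the square-exponential moments are bounded uniformly in `k` and `N_i`. -/
theorem lintegral_oddsAt_le (i : Fin K) {δ : ℝ} (hδ : 0 ≤ δ) (k : ℕ) :
    ∫⁻ w, ENNReal.ofReal (B.oddsAt i (B.muOn i - 2 * δ) δ k w) ∂B.prob ≤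
      ENNReal.ofReal (9 * Real.exp 13 * Real.exp (-(δ ^ 2 / 20 * k))) *
        (2 * gaussianSqExpMoment) := by
  have hk0 : (0 : ℝ) ≤ k := Nat.cast_nonneg k
  have hN0 : (0 : ℝ) ≤ B.N i := Nat.cast_nonneg _
  have hD1 := B.measurable_onDev i k
  have hD2 := B.measurable_hybDev i k
  have hae : ∀ᵐ w ∂B.prob, ∀ n, 0 ≤ w (.offline i n) :=
    ae_all_iff.2 fun n ↦ (B.ae_offline_mem_Icc i n).mono fun w hw ↦ hw.1
  have hpt : ∀ᵐ w ∂B.prob, ENNReal.ofReal (B.oddsAt i (B.muOn i - 2 * δ) δ k w) ≤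
      ENNReal.ofReal (9 * Real.exp 13 * Real.exp (-(δ ^ 2 / 20 * k))) *
        (ENNReal.ofReal (Real.exp (17 / 10 / (k + 1) * B.onDev i k w ^ 2)) +
          ENNReal.ofReal (Real.exp (17 / 10 / (k + B.N i + 1) * B.hybDev i k w ^ 2))) := by
    filter_upwards [hae] with w hw
    rw [← ENNReal.ofReal_add (by positivity) (by positivity),
      ← ENNReal.ofReal_mul (by positivity)]
    refine ENNReal.ofReal_le_ofReal ?_
    refine (oddsBound_le_of_le (by positivity) (B.onMean_standardized_le i k w δ)
      (B.hybMean_standardized_le i k hw hδ)).trans ?_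
    rw [div_pow, div_pow, mul_pow, Real.sq_sqrt (by positivity), Real.sq_sqrt (by positivity),
      neg_sq, neg_sq]
    have h1 : -(δ ^ 2 * ((k : ℝ) + 1) / 20) ≤ -(δ ^ 2 / 20 * k) := by nlinarith [sq_nonneg δ]
    have h2 : 17 / 10 * (B.onDev i k w ^ 2 / ((k : ℝ) + 1)) =
      17 / 10 / ((k : ℝ) + 1) * B.onDev i k w ^ 2 := by ring
    have h3 : 17 / 10 * (B.hybDev i k w ^ 2 / ((k : ℝ) + B.N i + 1)) =
      17 / 10 / ((k : ℝ) + B.N i + 1) * B.hybDev i k w ^ 2 := by ring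
    rw [h2, h3]
    gcongr
  refine (lintegral_mono_ae hpt).trans ?_
  rw [lintegral_const_mul _ (by fun_prop), lintegral_add_left (by fun_prop), two_mul]
  gcongr
  · refine (B.hasSubgaussianMGF_onDev i k).lintegral_exp_sq_le hD1 (by positivity) ?_
    push_cast
    rw [div_mul_eq_mul_div, div_le_iff₀ (by positivity)]
    linarith
  · refine (B.hasSubgaussianMGF_hybDev i k).lintegral_exp_sq_le hD2 (by positivity) ?_
    push_cast
    rw [div_mul_eq_mul_div, div_le_iff₀ (by positivity)]
    linarith

end Underestimation

end

end OfflineOnlineBandit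

namespace OfflineOnlineBandit

noncomputable section

variable {K : ℕ} (B : OfflineOnlineBandit K) {sel : ℕ → (Fin K → ℝ) → Fin K}

/-! ### Rounds in which a suboptimal arm is overestimated. -/

section Overestimation

theorem discrepancy_nonneg (i : Fin K) : 0 ≤ B.discrepancy i := by
  have := B.le_V i
  rw [discrepancy]
  linarith

theorem onMeanAt_le_of_onDev_lt {i : Fin K} {k : ℕ} {w : RandomSource K B.N → ℝ} {ε : ℝ}
    (hε : 0 ≤ ε) (h : B.onDev i k w < k * ε) : B.onMeanAt w i k ≤ B.muOn i + ε := by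
  rw [onMeanAt, sum_reward_eq, div_le_iff₀ (by positivity)]
  nlinarith [(B.muOn_mem_Icc i).1]

/-- Pooling gives the offline bias plus `V_i` the weight `N_i/(k + N_i) ≤ 1`, so the excess over
`μ_on` is at most the discrepancy. The regularization only lowers the nonnegative bound. -/
theorem hybMeanAt_le_of_hybDev_lt {i : Fin K} {k : ℕ} (hk : k ≠ 0) {w : RandomSource K B.N → ℝ}
    {ε : ℝ} (hε : 0 ≤ ε) (h : B.hybDev i k w < (k + B.N i) * ε) :
    B.hybMeanAt w i k ≤ B.muOn i + ε + B.discrepancy i := by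
  have hN0 : (0 : ℝ) ≤ B.N i := Nat.cast_nonneg _
  have hk0 : (0 : ℝ) < k := by exact_mod_cast Nat.pos_of_ne_zero hk
  have hn : (0 : ℝ) < (k : ℝ) + (B.N i : ℝ) := by linarith
  have hω := B.discrepancy_nonneg i
  have hnum : 0 ≤ (k + B.N i) * ε + k * B.muOn i + B.N i * B.muOff i :=
    add_nonneg (add_nonneg (mul_nonneg hn.le hε) (mul_nonneg hk0.le (B.muOn_mem_Icc i).1))
      (mul_nonneg hN0 (B.muOff_mem_Icc i).1)
  rw [hybMeanAt, if_neg hk, sum_reward_add_offMean_eq]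
  calc (B.hybDev i k w + k * B.muOn i + B.N i * B.muOff i) / ((k : ℝ) + B.N i + 1) +
        B.N i * B.V i / ((k : ℝ) + B.N i)
      ≤ ((k + B.N i) * ε + k * B.muOn i + B.N i * B.muOff i) / ((k : ℝ) + B.N i + 1) +
        B.N i * B.V i / ((k : ℝ) + B.N i) := by gcongr
    _ ≤ ((k + B.N i) * ε + k * B.muOn i + B.N i * B.muOff i) / ((k : ℝ) + B.N i) +
        B.N i * B.V i / ((k : ℝ) + B.N i) :=
        add_le_add (div_le_div_of_nonneg_left hnum hn (by linarith)) le_rfl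
    _ ≤ B.muOn i + ε + B.discrepancy i := by
        rw [← add_div, div_le_iff₀ hn]
        have : B.discrepancy i = B.V i + B.muOff i - B.muOn i := rfl
        nlinarith [mul_nonneg hk0.le hω]

/-- Noise below `x`, scaled by `(n + 1)^(-1/2)`, can bridge a distance `δ` only if `(n + 1)δ² < x²`.
-/
theorem lt_of_level_lt_sample {m s y δ x n z : ℝ} (hs : s = m + √(1 / (n + 1)) * z) (hn : 0 ≤ n)
    (hδ : 0 < δ) (hm : m + δ ≤ y) (hys : y < s) (hzx : z < x) : n * δ ^ 2 < x ^ 2 := by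
  have hn1 : 0 < n + 1 := by linarith
  have h1 : δ < √(1 / (n + 1)) * z := by linarith
  have hq : 0 < √(1 / (n + 1)) := by positivity
  have hz : 0 < z := by
    by_contra hz
    nlinarith [not_lt.1 hz]
  have h2 : δ < √(1 / (n + 1)) * x := h1.trans (by gcongr)
  have h3 : δ ^ 2 < (√(1 / (n + 1)) * x) ^ 2 := by gcongr
  rw [mul_pow, Real.sq_sqrt (by positivity), div_mul_eq_mul_div, one_mul, lt_div_iff₀ hn1] at h3
  nlinarith [sq_nonneg δ]

/-- If a suboptimal arm has a large index, then its samples deviate, or its posterior noise is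
large, or it has been pulled rarely. -/
theorem index_large_cases (w : RandomSource K B.N → ℝ) (t : ℕ) (i : Fin K) {Δ x : ℝ} (hΔ : 0 < Δ)
    (h : B.muOn i + 2 * (Δ / 3) < B.armIndex w (B.state sel w t) t i) :
    ((B.state sel w t).pulls i * (Δ / 6) ≤ B.onDev i ((B.state sel w t).pulls i) w ∨
      ((B.state sel w t).pulls i + B.N i) * (Δ / 6) ≤
        B.hybDev i ((B.state sel w t).pulls i) w ∨
      ((B.state sel w t).pulls i : ℝ) <
        36 * x ^ 2 / Δ ^ 2 - B.N i * max (1 - 3 * B.discrepancy i / Δ) 0) ∨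
    x ≤ w (.onNoise t i) ∨ x ≤ w (.hybNoise t i) := by
  rw [armIndex_state] at h
  generalize (B.state sel w t).pulls i = k at h ⊢
  by_contra! hcon
  obtain ⟨⟨h1, h2, h3⟩, h4, h5⟩ := hcon
  -- At `k = 0` the first alternative reads `0 ≤ 0`, so the first pull is charged to it.
  have hk : k ≠ 0 := by
    rintro rfl
    simp [onDev] at h1
  have hk0 : (0 : ℝ) ≤ k := Nat.cast_nonneg k
  have hN0 : (0 : ℝ) ≤ B.N i := Nat.cast_nonneg _
  have hω := B.discrepancy_nonneg i
  have hm := B.onMeanAt_le_of_onDev_lt (by positivity) h1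
  have hh := B.hybMeanAt_le_of_hybDev_lt hk (by positivity) h2
  have hboth : B.muOn i + 2 * (Δ / 3) < B.onMeanAt w i k + √(1 / ((k : ℝ) + 1)) * w (.onNoise t i) ∧
      B.muOn i + 2 * (Δ / 3) <
        B.hybMeanAt w i k + √(1 / ((k : ℝ) + B.N i + 1)) * w (.hybNoise t i) := by
    have hmy : ¬ B.muOn i + 2 * (Δ / 3) < B.onMeanAt w i k := by linarith
    rcases lt_median3_iff.1 h with h | ⟨h | h, h'⟩
    · exact absurd h.1 hmy
    · exact absurd h hmy
    · exact ⟨h, h'⟩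
  rw [sub_le_iff_le_add, div_le_iff₀ (by positivity)] at h3
  have hΔ2 : 0 < Δ ^ 2 := by positivity
  -- With discrepancy at most `Δ/3` the hybrid mean is at most `μ_i + Δ/6 + Δ/3`, still `Δ/6` below
  -- the level. Beyond `Δ/3` the claimed saving is zero and the online sample suffices.
  rcases le_or_gt (B.discrepancy i) (Δ / 3) with hd | hd
  · have h6 := lt_of_level_lt_sample (δ := Δ / 6) rfl (add_nonneg hk0 hN0) (by positivity)
      (by linarith) hboth.2 h5
    have h7 : max (1 - 3 * B.discrepancy i / Δ) 0 ≤ 1 :=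
      max_le (by have : 0 ≤ 3 * B.discrepancy i / Δ := by positivity
                 linarith) zero_le_one
    nlinarith [mul_le_mul_of_nonneg_left h7 (mul_nonneg hN0 hΔ2.le)]
  · have h6 := lt_of_level_lt_sample (δ := Δ / 6) rfl hk0 (by positivity) (by linarith) hboth.1 h4
    have h7 : max (1 - 3 * B.discrepancy i / Δ) 0 = 0 := by
      refine max_eq_right ?_
      rw [sub_nonpos, le_div_iff₀ hΔ]
      linarith
    rw [h7] at h3
    nlinarith

theorem measure_onNoise_ge_le (t : ℕ) (i : Fin K) {x : ℝ} (hx : 0 ≤ x) :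
    B.prob {w | x ≤ w (.onNoise t i)} ≤ ENNReal.ofReal (Real.exp (-x ^ 2 / 2)) :=
  ((B.measurePreserving_source (.onNoise t i)).measure_preimage
    measurableSet_Ici.nullMeasurableSet).trans_le (gaussianReal_Ici_le hx)

theorem measure_hybNoise_ge_le (t : ℕ) (i : Fin K) {x : ℝ} (hx : 0 ≤ x) :
    B.prob {w | x ≤ w (.hybNoise t i)} ≤ ENNReal.ofReal (Real.exp (-x ^ 2 / 2)) :=
  ((B.measurePreserving_source (.hybNoise t i)).measure_preimage
    measurableSet_Ici.nullMeasurableSet).trans_le (gaussianReal_Ici_le hx)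

/-- The expected number of pulls of an arm in a given set of pull counts and samples is at most the
sum of the probabilities. -/
theorem sum_measure_action_pulls_le (hsel : ∀ t, Measurable (sel t)) (i : Fin K)
    {E : ℕ → Set (RandomSource K B.N → ℝ)} (hE : ∀ k, MeasurableSet (E k)) (T : ℕ) :
    ∑ t ∈ Finset.range T, B.prob {w | B.action sel w t = i ∧ w ∈ E ((B.state sel w t).pulls i)} ≤
      ∑ k ∈ Finset.range T, B.prob (E k) := by
  classical
  let f : ℕ → (RandomSource K B.N → ℝ) → ENNReal := fun k ↦ (E k).indicator 1
  have hf : ∀ k, Measurable (f k) := fun k ↦ measurable_one.indicator (hE k)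
  have hm : ∀ t, Measurable fun w ↦
      if B.action sel w t = i then f ((B.state sel w t).pulls i) w else 0 := fun t ↦
    Measurable.ite (B.measurableSet_action_eq hsel t i)
      (Measurable.comp_nat hf (B.measurable_pulls hsel t i)) measurable_const
  calc ∑ t ∈ Finset.range T,
        B.prob {w | B.action sel w t = i ∧ w ∈ E ((B.state sel w t).pulls i)}
      ≤ ∑ t ∈ Finset.range T, ∫⁻ w,
        (if B.action sel w t = i then f ((B.state sel w t).pulls i) w else 0) ∂B.prob := by
        refine Finset.sum_le_sum fun t _ ↦ ?_
        refine (meas_le_lintegral₀ (hm t).aemeasurable ?_)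
        rintro w ⟨h1, h2⟩
        simp [f, h1, h2]
    _ = ∫⁻ w, ∑ k ∈ Finset.range ((B.state sel w T).pulls i), f k w ∂B.prob := by
        rw [← lintegral_finsetSum _ fun t _ ↦ hm t]
        refine lintegral_congr fun w ↦ ?_
        exact B.sum_range_action_eq sel w (fun k ↦ f k w) i T
    _ ≤ ∫⁻ w, ∑ k ∈ Finset.range T, f k w ∂B.prob := lintegral_mono fun w ↦
        Finset.sum_le_sum_of_subset (Finset.range_mono (B.pulls_le sel w T i))
    _ = ∑ k ∈ Finset.range T, B.prob (E k) := by
        rw [lintegral_finsetSum _ fun k _ ↦ hf k]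
        exact Finset.sum_congr rfl fun k _ ↦ lintegral_indicator_one (hE k)

theorem sum_range_ite_cast_lt_le (M : ℝ) (T : ℕ) :
    ∑ k ∈ Finset.range T, (if (k : ℝ) < M then (1 : ENNReal) else 0) ≤
      ENNReal.ofReal (max M 0 + 1) := by
  rw [Finset.sum_ite, Finset.sum_const_zero, add_zero, Finset.sum_const, nsmul_eq_mul, mul_one]
  have hsub : (Finset.range T).filter (fun k : ℕ ↦ (k : ℝ) < M) ⊆ Finset.range ⌈M⌉₊ := fun k hk ↦
    Finset.mem_range.2 (Nat.lt_ceil.2 (Finset.mem_filter.1 hk).2)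
  have h1 := Finset.card_le_card hsub
  rw [Finset.card_range] at h1
  have h2 : (⌈M⌉₊ : ℝ) ≤ max M 0 + 1 := by
    have h3 : (⌈M⌉₊ : ℝ) ≤ ⌈max M 0⌉₊ := by
      exact_mod_cast Nat.ceil_mono (le_max_left M 0)
    exact h3.trans (Nat.ceil_lt_add_one (le_max_right M 0)).le
  rw [← ENNReal.ofReal_natCast]
  exact ENNReal.ofReal_le_ofReal ((Nat.cast_le.2 h1).trans h2)

/-- The expected number of rounds in which a suboptimal arm is pulled with a large index. -/
theorem sum_measure_action_index_large_le (hsel : ∀ t, Measurable (sel t)) (i : Fin K) {Δ : ℝ}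
    (hΔ : 0 < Δ) {T : ℕ} (hT : 1 ≤ T) :
    ∑ t ∈ Finset.range T, B.prob {w | B.action sel w t = i ∧
        B.muOn i + 2 * (Δ / 3) < B.armIndex w (B.state sel w t) t i} ≤
      ENNReal.ofReal (max (72 * Real.log T / Δ ^ 2 -
        B.N i * max (1 - 3 * B.discrepancy i / Δ) 0) 0 + (5 + 36 / Δ ^ 2)) := by
  set M := 72 * Real.log T / Δ ^ 2 - B.N i * max (1 - 3 * B.discrepancy i / Δ) 0 with hM
  have hT0 : (0 : ℝ) < T := by exact_mod_cast hT
  have hlog : 0 ≤ Real.log T := Real.log_nonneg (by exact_mod_cast hT)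
  -- Each noise then exceeds `x` with probability at most `1/T`, so the two noises cost at most `2`
  -- over all rounds; this also gives `36 x² = 72 log T`.
  set x := √(2 * Real.log T) with hx
  have hx2 : x ^ 2 = 2 * Real.log T := Real.sq_sqrt (by positivity)
  have hexp : Real.exp (-x ^ 2 / 2) = 1 / T := by
    rw [hx2, show -(2 * Real.log T) / 2 = -Real.log T by ring, Real.exp_neg, Real.exp_log hT0,
      one_div]
  let E₁ : ℕ → Set (RandomSource K B.N → ℝ) := fun k ↦ {w | k * (Δ / 6) ≤ B.onDev i k w}
  let E₂ : ℕ → Set (RandomSource K B.N → ℝ) := fun k ↦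
    {w | (k + B.N i) * (Δ / 6) ≤ B.hybDev i k w}
  let E₃ : ℕ → Set (RandomSource K B.N → ℝ) := fun k ↦ {_w | (k : ℝ) < M}
  have hE₁ : ∀ k, MeasurableSet (E₁ k) := fun k ↦
    measurableSet_le measurable_const (B.measurable_onDev i k)
  have hE₂ : ∀ k, MeasurableSet (E₂ k) := fun k ↦
    measurableSet_le measurable_const (B.measurable_hybDev i k)
  have hE₃ : ∀ k, MeasurableSet (E₃ k) := fun k ↦ MeasurableSet.const _
  have hcases : ∀ t, B.prob {w | B.action sel w t = i ∧
        B.muOn i + 2 * (Δ / 3) < B.armIndex w (B.state sel w t) t i} ≤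
      B.prob {w | B.action sel w t = i ∧
        w ∈ E₁ ((B.state sel w t).pulls i) ∪ (E₂ ((B.state sel w t).pulls i) ∪
          E₃ ((B.state sel w t).pulls i))} +
      (ENNReal.ofReal (1 / T) + ENNReal.ofReal (1 / T)) := fun t ↦ by
    calc _ ≤ B.prob ({w | B.action sel w t = i ∧
        w ∈ E₁ ((B.state sel w t).pulls i) ∪ (E₂ ((B.state sel w t).pulls i) ∪
          E₃ ((B.state sel w t).pulls i))} ∪
          ({w | x ≤ w (.onNoise t i)} ∪ {w | x ≤ w (.hybNoise t i)})) := by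
          refine measure_mono ?_
          rintro w ⟨ha, hw⟩
          rcases B.index_large_cases w t i (x := x) hΔ hw with h | h
          · refine .inl ⟨ha, ?_⟩
            rw [hx2, show 36 * (2 * Real.log T) = 72 * Real.log T by ring, ← hM] at h
            exact h
          · exact .inr h
      _ ≤ _ := (measure_union_le _ _).trans (add_le_add le_rfl
          ((measure_union_le _ _).trans ?_))
    rw [← hexp]
    exact add_le_add (B.measure_onNoise_ge_le t i (Real.sqrt_nonneg _))
      (B.measure_hybNoise_ge_le t i (Real.sqrt_nonneg _))
  have hdev : ∑ k ∈ Finset.range T, ENNReal.ofReal (Real.exp (-(2 * (Δ / 6) ^ 2 * k))) ≤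
      ENNReal.ofReal (1 + 18 / Δ ^ 2) := by
    rw [← ENNReal.ofReal_sum_of_nonneg fun _ _ ↦ (Real.exp_pos _).le]
    refine ENNReal.ofReal_le_ofReal
      ((sum_range_exp_neg_mul_le (by positivity) T).trans (le_of_eq ?_))
    field_simp
    ring
  have hsum : ∑ t ∈ Finset.range T, B.prob {w | B.action sel w t = i ∧
        w ∈ E₁ ((B.state sel w t).pulls i) ∪ (E₂ ((B.state sel w t).pulls i) ∪
          E₃ ((B.state sel w t).pulls i))} ≤
      ENNReal.ofReal (1 + 18 / Δ ^ 2) +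
        (ENNReal.ofReal (1 + 18 / Δ ^ 2) + ENNReal.ofReal (max M 0 + 1)) := by
    refine (B.sum_measure_action_pulls_le hsel i
      (E := fun k ↦ E₁ k ∪ (E₂ k ∪ E₃ k))
      (fun k ↦ (hE₁ k).union ((hE₂ k).union (hE₃ k))) T).trans ?_
    calc ∑ k ∈ Finset.range T, B.prob (E₁ k ∪ (E₂ k ∪ E₃ k))
        ≤ ∑ k ∈ Finset.range T, (B.prob (E₁ k) + (B.prob (E₂ k) + B.prob (E₃ k))) :=
          Finset.sum_le_sum fun k _ ↦ (measure_union_le _ _).trans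
            (add_le_add le_rfl (measure_union_le _ _))
      _ ≤ ∑ k ∈ Finset.range T, (ENNReal.ofReal (Real.exp (-(2 * (Δ / 6) ^ 2 * k))) +
          (ENNReal.ofReal (Real.exp (-(2 * (Δ / 6) ^ 2 * k))) +
            if (k : ℝ) < M then 1 else 0)) := by
          refine Finset.sum_le_sum fun k _ ↦ add_le_add
            (B.measure_onDev_ge_le i k (by positivity)) (add_le_add
              (B.measure_hybDev_ge_le i k (by positivity)) ?_)
          by_cases hk : (k : ℝ) < M <;> simp [E₃, hk]
      _ ≤ _ := by
          rw [Finset.sum_add_distrib, Finset.sum_add_distrib]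
          exact add_le_add hdev (add_le_add hdev (sum_range_ite_cast_lt_le M T))
  refine (Finset.sum_le_sum fun t _ ↦ hcases t).trans ?_
  rw [Finset.sum_add_distrib, Finset.sum_const, Finset.card_range, nsmul_eq_mul,
    ← ENNReal.ofReal_add (by positivity) (by positivity), ← ENNReal.ofReal_natCast,
    ← ENNReal.ofReal_mul (by positivity)]
  refine (add_le_add hsum le_rfl).trans (le_of_eq ?_)
  rw [← ENNReal.ofReal_add (by positivity) (by positivity),
    ← ENNReal.ofReal_add (by positivity) (by positivity),
    ← ENNReal.ofReal_add (by positivity) (by positivity)]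
  -- The two deviation sums give `2(1 + 18/Δ²)`, rounding up the threshold gives `1`, and the noises
  -- give `2`.
  congr 1
  field_simp
  ring

end Overestimation

/-! ### Expected pulls of a suboptimal arm and the regret bound. -/

/-- Absolute constant of the bound for the expected number of suboptimal pulls. -/
def pullConst : ℝ := 41 + 18 * 721 * Real.exp 13 * gaussianSqExpMoment.toReal

theorem pullConst_pos : 0 < pullConst := by
  have : 0 ≤ gaussianSqExpMoment.toReal := ENNReal.toReal_nonneg
  unfold pullConst
  positivity

theorem gap_le_one (best i : Fin K) : B.gap best i ≤ 1 := by
  rw [gap]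
  linarith [(B.muOn_mem_Icc best).2, (B.muOn_mem_Icc i).1]

/-- The expected number of pulls of a suboptimal arm. -/
theorem sum_measureReal_action_le (hsel : ∀ t, Measurable (sel t))
    (hmax : ∀ (t : ℕ) (v : Fin K → ℝ) (j : Fin K), v j ≤ v (sel t v)) {best i : Fin K}
    (hgap : 0 < B.gap best i) (T : ℕ) :
    ∑ t ∈ Finset.range T, B.prob.real {w | B.action sel w t = i} ≤
      max (72 * Real.log T / B.gap best i ^ 2 -
        B.N i * max (1 - 3 * B.discrepancy i / B.gap best i) 0) 0 +
        pullConst / B.gap best i ^ 2 := by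
  have hC := pullConst_pos
  rcases Nat.eq_zero_or_pos T with rfl | hT
  · simp only [Finset.range_zero, Finset.sum_empty]
    exact add_nonneg (le_max_right _ _) (by positivity)
  set Δ := B.gap best i with hΔ
  have hΔ1 : Δ ≤ 1 := B.gap_le_one best i
  -- One level serves both halves: it is `2δ` below the best mean with `δ = Δ/6`, as the odds bound
  -- requires, and `2Δ/3` above the mean of arm `i`.
  have hy : B.muOn i + 2 * (Δ / 3) = B.muOn best - 2 * (Δ / 6) := by rw [hΔ, gap]; ring
  have hunder : ∑ t ∈ Finset.range T, B.prob {w | B.action sel w t = i ∧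
        B.armIndex w (B.state sel w t) t i ≤ B.muOn i + 2 * (Δ / 3)} ≤
      ENNReal.ofReal (18 * Real.exp 13 * gaussianSqExpMoment.toReal * (1 + 720 / Δ ^ 2)) := by
    refine (B.sum_measure_action_index_le hsel hmax best i _ (δ := Δ / 6) (by positivity) T).trans ?_
    rw [hy]
    refine (Finset.sum_le_sum fun k _ ↦ B.lintegral_oddsAt_le best (by positivity) k).trans ?_
    rw [← Finset.sum_mul, ← ENNReal.ofReal_sum_of_nonneg fun _ _ ↦ by positivity,
      ← Finset.mul_sum]
    have hG : (2 : ENNReal) * gaussianSqExpMoment =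
        ENNReal.ofReal (2 * gaussianSqExpMoment.toReal) := by
      rw [ENNReal.ofReal_mul zero_le_two, ENNReal.ofReal_toReal gaussianSqExpMoment_ne_top]
      simp
    have hG0 : 0 ≤ gaussianSqExpMoment.toReal := ENNReal.toReal_nonneg
    rw [hG, ← ENNReal.ofReal_mul
      (mul_nonneg (by positivity) (Finset.sum_nonneg fun _ _ ↦ (Real.exp_pos _).le))]
    refine ENNReal.ofReal_le_ofReal ?_
    have hs := sum_range_exp_neg_mul_le (c := (Δ / 6) ^ 2 / 20) (by positivity) T
    have h720 : 1 / ((Δ / 6) ^ 2 / 20) = 720 / Δ ^ 2 := by field_simp; norm_num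
    rw [h720] at hs
    calc _ ≤ 9 * Real.exp 13 * (1 + 720 / Δ ^ 2) * (2 * gaussianSqExpMoment.toReal) := by gcongr
      _ = _ := by ring
  have hover := B.sum_measure_action_index_large_le hsel i hgap hT
  have hsplit : ∀ t, B.prob {w | B.action sel w t = i} ≤
      B.prob {w | B.action sel w t = i ∧
        B.armIndex w (B.state sel w t) t i ≤ B.muOn i + 2 * (Δ / 3)} +
      B.prob {w | B.action sel w t = i ∧
        B.muOn i + 2 * (Δ / 3) < B.armIndex w (B.state sel w t) t i} := fun t ↦ by
    refine (measure_mono fun w hw ↦ ?_).trans (measure_union_le _ _)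
    rcases le_or_gt (B.armIndex w (B.state sel w t) t i) (B.muOn i + 2 * (Δ / 3)) with h | h
    · exact .inl ⟨hw, h⟩
    · exact .inr ⟨hw, h⟩
  set M := max (72 * Real.log T / Δ ^ 2 - B.N i * max (1 - 3 * B.discrepancy i / Δ) 0) 0
  have hM0 : 0 ≤ M := le_max_right _ _
  have htotal : ENNReal.ofReal (∑ t ∈ Finset.range T, B.prob.real {w | B.action sel w t = i}) ≤
      ENNReal.ofReal (M + pullConst / Δ ^ 2) := by
    rw [ENNReal.ofReal_sum_of_nonneg fun _ _ ↦ measureReal_nonneg]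
    rw [Finset.sum_congr rfl fun t _ ↦ ofReal_measureReal]
    refine (Finset.sum_le_sum fun t _ ↦ hsplit t).trans ?_
    rw [Finset.sum_add_distrib]
    refine (add_le_add hunder hover).trans ?_
    have hG0 : 0 ≤ gaussianSqExpMoment.toReal := ENNReal.toReal_nonneg
    rw [← ENNReal.ofReal_add (by positivity) (by positivity)]
    refine ENNReal.ofReal_le_ofReal ?_
    -- Since `Δ ≤ 1`, additive constants are absorbed into `1/Δ²`: `5 + 36` becomes `41`, and `1 +
    -- 720` becomes `721`.
    have h1 : 1 ≤ 1 / Δ ^ 2 := by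
      rw [le_div_iff₀ (by positivity), one_mul]
      exact pow_le_one₀ hgap.le hΔ1
    have h2 : 18 * Real.exp 13 * gaussianSqExpMoment.toReal * (1 + 720 / Δ ^ 2) ≤
        18 * Real.exp 13 * gaussianSqExpMoment.toReal * (721 * (1 / Δ ^ 2)) := by
      gcongr
      rw [show 720 / Δ ^ 2 = 720 * (1 / Δ ^ 2) by ring]
      linarith
    have h3 : pullConst / Δ ^ 2 = 41 * (1 / Δ ^ 2) +
        18 * Real.exp 13 * gaussianSqExpMoment.toReal * (721 * (1 / Δ ^ 2)) := by
      rw [pullConst]; ring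
    rw [h3, show 36 / Δ ^ 2 = 36 * (1 / Δ ^ 2) by ring]
    linarith
  exact (ENNReal.ofReal_le_ofReal_iff (by positivity)).1 htotal

end

end OfflineOnlineBandit

/-- Regret bound for Anchor-TS, with absolute constants, for every measurable way `sel` of breaking
ties in the arg max; the second part is the order of the bound for purely online Thompson
sampling. -/
theorem theorem1 :
    ∃ C C₁ C₂ C₃ : ℝ, 0 < C ∧ 0 < C₁ ∧ 0 < C₂ ∧ 0 < C₃ ∧
      ∀ (K : ℕ) (B : OfflineOnlineBandit K) (best : Fin K)
        (_hbest : ∀ i : Fin K, i ≠ best → B.muOn i < B.muOn best)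
        (sel : ℕ → (Fin K → ℝ) → Fin K)
        (_hsel_meas : ∀ t, Measurable (sel t))
        (_hsel_max : ∀ (t : ℕ) (v : Fin K → ℝ) (j : Fin K), v j ≤ v (sel t v))
        (T : ℕ),
        B.regret best sel T ≤
          C * ∑ i ∈ Finset.univ.erase best, B.gap best i *
            (max (C₁ * Real.log T / B.gap best i ^ 2
                - (B.N i : ℝ) * max (1 - 3 * B.discrepancy i / B.gap best i) 0) 0
              + max (C₂ * Real.log T / B.gap best i ^ 2 - (B.N best : ℝ)) 0
              + C₃ / B.gap best i ^ 2)
        ∧ B.regret best sel T ≤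
          C * ∑ i ∈ Finset.univ.erase best,
            ((C₁ + C₂) * Real.log T + C₃) / B.gap best i := by
  -- The pull bound already holds without the term in `N best`, which is nonnegative; hence any
  -- positive `C₂` works, and `1` is taken.
  refine ⟨1, 72, 1, OfflineOnlineBandit.pullConst, one_pos, by norm_num, one_pos,
    OfflineOnlineBandit.pullConst_pos, fun K B best hbest sel hsel hmax T ↦ ?_⟩
  have hlog : 0 ≤ Real.log T := Real.log_natCast_nonneg T
  have hgap : ∀ i ∈ Finset.univ.erase best, 0 < B.gap best i := fun i hi ↦
    sub_pos_of_lt (hbest i (Finset.ne_of_mem_erase hi))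
  have hfirst : B.regret best sel T ≤
      1 * ∑ i ∈ Finset.univ.erase best, B.gap best i *
        (max (72 * Real.log T / B.gap best i ^ 2
            - (B.N i : ℝ) * max (1 - 3 * B.discrepancy i / B.gap best i) 0) 0
          + max (1 * Real.log T / B.gap best i ^ 2 - (B.N best : ℝ)) 0
          + OfflineOnlineBandit.pullConst / B.gap best i ^ 2) := by
    rw [B.regret_eq_sum_gap_mul hsel, one_mul]
    refine Finset.sum_le_sum fun i hi ↦ mul_le_mul_of_nonneg_left ?_ (hgap i hi).le
    have h := B.sum_measureReal_action_le hsel hmax (hgap i hi) T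
    have h0 := le_max_right (1 * Real.log T / B.gap best i ^ 2 - (B.N best : ℝ)) 0
    linarith
  refine ⟨hfirst, hfirst.trans ?_⟩
  simp only [one_mul]
  refine Finset.sum_le_sum fun i hi ↦ ?_
  have hΔ := hgap i hi
  have hN : ∀ j, (0 : ℝ) ≤ B.N j := fun j ↦ Nat.cast_nonneg _
  have h0 := mul_nonneg (hN i) (le_max_right (1 - 3 * B.discrepancy i / B.gap best i) 0)
  have h1 : max (72 * Real.log T / B.gap best i ^ 2
      - (B.N i : ℝ) * max (1 - 3 * B.discrepancy i / B.gap best i) 0) 0 ≤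
      72 * Real.log T / B.gap best i ^ 2 :=
    max_le (by linarith [h0]) (by positivity)
  have h2 : max (Real.log T / B.gap best i ^ 2 - (B.N best : ℝ)) 0 ≤
      Real.log T / B.gap best i ^ 2 :=
    max_le (by linarith [hN best]) (by positivity)
  calc _ ≤ B.gap best i * (72 * Real.log T / B.gap best i ^ 2 +
        Real.log T / B.gap best i ^ 2 +
        OfflineOnlineBandit.pullConst / B.gap best i ^ 2) := by gcongr
    _ = _ := by field_simp
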